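/- All vector spaces are finite-dimensional over $\mathbb C$. A *weak PM-structure* (of size $p$) on a space $\mathcal L$ consists of subspaces $\mathcal A,\mathcal B\subset\mathcal L$, an element $1\in\mathcal A\cap\mathcal B$, a non-degenerate symmetric bilinear form $(\cdot,\cdot)$ on $\mathcal L$, associative products on $\mathcal A$ and on $\mathcal B$ with unity $1$, and a left action of $\mathcal B$ and a right action of $\mathcal A$ on $\mathcal L$ that commute, such that (i) $\dim(\mathcal A\cap\mathcal B)=\dim\mathcal L/(\mathcal A+\mathcal B)=p$ and $\mathcal A\cap\mathcal B$ is an algebra isomorphic to $\mathbb C^{p}$; (ii) the actions restricted to $\mathcal B$ and $\mathcal A$ are the products of $\mathcal B$ and $\mathcal A$; (iii) $(a_1,a_2)=(b_1,b_2)=0$, $(b_1b_2,v)=(b_1,b_2v)$ and $(v,a_1a_2)=(va_1,a_2)$ for all $a_i\in\mathcal A$, $b_i\in\mathcal B$, $v\in\mathcal L$. It is *indecomposable* if there are no nonzero subspaces $\mathcal L_1,\mathcal L_2$ with $\mathcal L=\mathcal L_1\oplus\mathcal L_2$, $\mathcal A=(\mathcal A\cap\mathcal L_1)\oplus(\mathcal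 A\cap\mathcal L_2)$, $\mathcal B=(\mathcal B\cap\mathcal L_1)\oplus(\mathcal B\cap\mathcal L_2)$ for which $\mathcal A$ and $\mathcal B$ act componentwise on $\mathcal L_1\oplus\mathcal L_2$. Let $\mathcal A\cong\bigoplus_{i=1}^r\mathrm{End}(V_i)$ and $\mathcal B\cong\bigoplus_{j=1}^s\mathrm{End}(W_j)$ be semisimple, with $m_i=\dim V_i\ge 1$ and $n_j=\dim W_j\ge 1$. An $r\times s$ matrix $A=(a_{i,j})$ of non-negative integers is a *matrix of multiplicities* if $\mathcal L\cong\bigoplus_{i,j}(V_i^*\otimes W_j)^{a_{i,j}}$ as a right $\mathcal A$-module and left $\mathcal B$-module. **Theorem.** Let $A=(a_{i,j})$ be the matrix of multiplicities of a nonzero indecomposable weak PM-structure with semisimple $\mathcal A$ and $\mathcal B$. Then, after a permutation of the rows and of the columns (with the corresponding permutation of the $m_i$ and of the $n_j$) and possibly a transposition (which exchanges $r$ with $s$ and $(m_i)$ with $(n_j)$), there is an integer $m\ge 1$ such that $A$, $(m_i)$ and $(n_j)$ are one of the following. Moreover, the diagram with one vertex for each row and each column of $A$ and $a_{i,j}$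 edges between row $i$ and column $j$ is the indicated simply laced affine Dynkin diagram. Entries not mentioned are $0$. 1. $\tilde A_1$: $A=(2)$, $m_1=n_1=m$. 2. $\tilde A_{2k-1}$, $k\ge2$: $r=s=k$, $a_{i,i}=a_{i,i+1}=1$ with indices modulo $k$; $m_i=n_i=m$. 3. $\tilde E_6$: $A=\begin{pmatrix}1&1&0&0\\1&0&1&0\\1&0&0&1\end{pmatrix}$; $(m_i)=m(2,2,2)$, $(n_j)=m(3,1,1,1)$. 4. $\tilde D_4$: $A=(1,1,1,1)$; $m_1=2m$, $(n_j)=m(1,1,1,1)$. 5. $\tilde D_{2k}$, $k\ge3$: $r=k-1$, $s=k+2$; $a_{1,1}=a_{1,2}=a_{1,3}=1$, $a_{i,i+1}=a_{i,i+2}=1$ for $2\le i\le k-2$, $a_{k-1,k}=a_{k-1,k+1}=a_{k-1,k+2}=1$; all $m_i=2m$, $n_1=n_2=n_{k+1}=n_{k+2}=m$, $n_3=\dots=n_k=2m$. 6. $\tilde D_{2k-1}$, $k\ge3$: $r=s=k$; $a_{1,1}=a_{1,2}=a_{1,3}=1$, $a_{i,i+1}=a_{i,i+2}=1$ for $2\le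 i\le k-2$, $a_{k-1,k}=a_{k,k}=1$; $m_1=\dots=m_{k-2}=2m$, $m_{k-1}=m_k=m$, $n_1=n_2=m$, $n_3=\dots=n_k=2m$. 7. $\tilde E_7$: $A=\begin{pmatrix}1&1&0&0&0\\0&1&1&1&0\\0&0&0&1&1\end{pmatrix}$; $(m_i)=m(2,4,2)$, $(n_j)=m(1,3,2,3,1)$. 8. $\tilde E_8$: $A=\begin{pmatrix}1&0&0&0&0\\1&1&1&0&0\\0&0&1&1&0\\0&0&0&1&1\end{pmatrix}$; $(m_i)=m(2,6,4,2)$, $(n_j)=m(4,3,5,3,1)$. -/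

import Mathlib

open scoped TensorProduct

namespace PM

/-! ### Weak PM-structures -/

/-- A weak PM-structure of size `m` on the complex vector space `L`.

The associative unital algebras `A` and `B` are identified with subspaces of `L` through the
injective linear maps `inclA` and `inclB`. The instance arguments say that `L` is a left
`B`-module and a right `A`-module (a left module over the opposite algebra, so that
`MulOpposite.op a • v` is `v a`), that both actions are bilinear over `ℂ`, and that they commute. -/
structure WeakPMStructure (A B L : Type*) [Ring A] [Algebra ℂ A] [Ring B] [Algebra ℂ B]
    [AddCommGroup L] [Module ℂ L] [Module B L] [Module Aᵐᵒᵖ L]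
    [IsScalarTower ℂ B L] [IsScalarTower ℂ Aᵐᵒᵖ L] [SMulCommClass B Aᵐᵒᵖ L] (m : ℕ) where
  /-- the inclusion of `A` in `L` -/
  inclA : A →ₗ[ℂ] L
  /-- the inclusion of `B` in `L` -/
  inclB : B →ₗ[ℂ] L
  inclA_injective : Function.Injective inclA
  inclB_injective : Function.Injective inclB
  /-- `A` and `B` have the same unity, a distinguished element of `L` -/
  incl_one : inclA 1 = inclB 1
  /-- the scalar product on `L` -/
  form : LinearMap.BilinForm ℂ L
  form_symm : form.IsSymm
  form_nondegenerate : form.Nondegenerate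
  finrank_inf : Module.finrank ℂ ↥(LinearMap.range inclA ⊓ LinearMap.range inclB) = m
  finrank_quotient :
    Module.finrank ℂ (L ⧸ (LinearMap.range inclA ⊔ LinearMap.range inclB)) = m
  /-- the intersection of `A` and `B` is a subalgebra isomorphic to `ℂ ⊕ ⋯ ⊕ ℂ` -/
  inf_algebra : ∃ f : (Fin m → ℂ) →ₐ[ℂ] A, Function.Injective f ∧
    LinearMap.range (inclA ∘ₗ f.toLinearMap) = LinearMap.range inclA ⊓ LinearMap.range inclB
  /-- the right action of `A` on `L` restricts to the product of `A` -/
  inclA_mul : ∀ a₁ a₂ : A, inclA (a₁ * a₂) = MulOpposite.op a₂ • inclA a₁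
  /-- the left action of `B` on `L` restricts to the product of `B` -/
  inclB_mul : ∀ b₁ b₂ : B, inclB (b₁ * b₂) = b₁ • inclB b₂
  form_A_A : ∀ a₁ a₂ : A, form (inclA a₁) (inclA a₂) = 0
  form_B_B : ∀ b₁ b₂ : B, form (inclB b₁) (inclB b₂) = 0
  form_mul_B : ∀ (b₁ b₂ : B) (v : L), form (inclB (b₁ * b₂)) v = form (inclB b₁) (b₂ • v)
  form_mul_A : ∀ (a₁ a₂ : A) (v : L),
    form v (inclA (a₁ * a₂)) = form (MulOpposite.op a₁ • v) (inclA a₂)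

section Decomposition

variable {A B L : Type*} [Ring A] [Algebra ℂ A] [Ring B] [Algebra ℂ B]
  [AddCommGroup L] [Module ℂ L] [Module B L] [Module Aᵐᵒᵖ L]
  [IsScalarTower ℂ B L] [IsScalarTower ℂ Aᵐᵒᵖ L] [SMulCommClass B Aᵐᵒᵖ L] {m : ℕ}

/-- `L` is the direct sum of two nonzero subspaces `L₁` and `L₂` such that
`A = (A ∩ L₁) ⊕ (A ∩ L₂)`, `B = (B ∩ L₁) ⊕ (B ∩ L₂)`, and `A` and `B` act componentwise.

Then `A ∩ L₁` and `B ∩ L₁` are orthogonal to `L₂` (and symmetrically), the scalar product restricts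
to a non-degenerate one on each `Lᵢ`, and each `Lᵢ` is a weak PM-structure with the restricted data.
Orthogonality of `L₁` and `L₂` themselves is not demanded: the axioms leave the scalar product
between complements of `A + B` in `L₁` and in `L₂` free, and it can be made zero
without affecting any other part of the structure. -/
def WeakPMStructure.IsDecomposable (S : WeakPMStructure A B L m) : Prop :=
  ∃ L₁ L₂ : Submodule ℂ L, L₁ ≠ ⊥ ∧ L₂ ≠ ⊥ ∧ IsCompl L₁ L₂ ∧
    (∀ a : A, ∃ a₁ a₂ : A, a = a₁ + a₂ ∧ S.inclA a₁ ∈ L₁ ∧ S.inclA a₂ ∈ L₂) ∧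
    (∀ b : B, ∃ b₁ b₂ : B, b = b₁ + b₂ ∧ S.inclB b₁ ∈ L₁ ∧ S.inclB b₂ ∈ L₂) ∧
    (∀ a : A, S.inclA a ∈ L₁ →
      (∀ v ∈ L₁, MulOpposite.op a • v ∈ L₁) ∧ ∀ v ∈ L₂, MulOpposite.op a • v = 0) ∧
    (∀ a : A, S.inclA a ∈ L₂ →
      (∀ v ∈ L₁, MulOpposite.op a • v = 0) ∧ ∀ v ∈ L₂, MulOpposite.op a • v ∈ L₂) ∧
    (∀ b : B, S.inclB b ∈ L₁ → (∀ v ∈ L₁, b • v ∈ L₁) ∧ ∀ v ∈ L₂, b • v = 0) ∧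
    (∀ b : B, S.inclB b ∈ L₂ → (∀ v ∈ L₁, b • v = 0) ∧ ∀ v ∈ L₂, b • v ∈ L₂)

/-- A weak PM-structure that is not a direct sum of two nonzero ones. -/
def WeakPMStructure.IsIndecomposable (S : WeakPMStructure A B L m) : Prop :=
  ¬ S.IsDecomposable

end Decomposition

/-! ### The matrix of multiplicities -/

/-- `a` is the matrix of multiplicities of `L` with respect to given decompositions
`A ≅ ⨁ᵢ End(Vᵢ)` and `B ≅ ⨁ⱼ End(Wⱼ)`: as a right `A`-module and left `B`-module, `L` is isomorphic
to the direct sum over `i, j` of `aᵢⱼ` copies of `Vᵢ* ⊗ Wⱼ`, where `End(Vᵢ)` acts on `Vᵢ*` from the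
right by transposition. -/
def IsMatrixOfMultiplicities {A B : Type*} (L : Type*) [Ring A] [Algebra ℂ A] [Ring B]
    [Algebra ℂ B] [AddCommGroup L] [Module ℂ L] [Module B L] [Module Aᵐᵒᵖ L] {r s : ℕ}
    {V : Fin r → Type*} [∀ i, AddCommGroup (V i)] [∀ i, Module ℂ (V i)]
    {W : Fin s → Type*} [∀ j, AddCommGroup (W j)] [∀ j, Module ℂ (W j)]
    (φ : A ≃ₐ[ℂ] (∀ i, Module.End ℂ (V i))) (ψ : B ≃ₐ[ℂ] (∀ j, Module.End ℂ (W j)))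
    (a : Matrix (Fin r) (Fin s) ℕ) : Prop :=
  ∃ Φ : L ≃ₗ[ℂ] (∀ i j, Fin (a i j) → Module.Dual ℂ (V i) ⊗[ℂ] W j),
    (∀ (x : A) (v : L) i j t,
      Φ (MulOpposite.op x • v) i j t = (φ x i).dualMap.rTensor (W j) (Φ v i j t)) ∧
    (∀ (y : B) (v : L) i j t,
      Φ (y • v) i j t = (ψ y j).lTensor (Module.Dual ℂ (V i)) (Φ v i j t))

/-! ### Simply laced affine Dynkin diagrams

A diagram is given by its symmetric matrix of edge multiplicities. -/

/-- `Ã n` for `n ≥ 1`: the cycle on `n + 1` vertices; for `n = 1`, two vertices joined by two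
edges. -/
def affineA (n : ℕ) : Matrix (Fin (n + 1)) (Fin (n + 1)) ℕ := fun i j =>
  (if j.val = (i.val + 1) % (n + 1) then 1 else 0) +
    (if i.val = (j.val + 1) % (n + 1) then 1 else 0)

/-- The simple graph on `{0, …, N - 1}` with edges the pairs `i < j` that satisfy `E i j`. -/
def graphOf (N : ℕ) (E : ℕ → ℕ → Prop) [DecidableRel E] : Matrix (Fin N) (Fin N) ℕ := fun i j =>
  if (i < j ∧ E i j) ∨ (j < i ∧ E j i) then 1 else 0

/-- `D̃ n` for `n ≥ 4`: the path `1, 2, …, n - 1`, with `0` joined to `2` and `n` to `n - 2`. -/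
def affineD (n : ℕ) : Matrix (Fin (n + 1)) (Fin (n + 1)) ℕ :=
  graphOf (n + 1) fun i j =>
    (1 ≤ i ∧ j = i + 1 ∧ j + 1 ≤ n) ∨ (i = 0 ∧ j = 2) ∨ (i + 2 = n ∧ j = n)

/-- `Ẽ 6`: arms `1, 2` and `3, 4` and `5, 6` attached to `0`. -/
def affineE6 : Matrix (Fin 7) (Fin 7) ℕ :=
  graphOf 7 fun i j => (i, j) ∈ [(0, 1), (1, 2), (0, 3), (3, 4), (0, 5), (5, 6)]

/-- `Ẽ 7`: arms `1, 2, 3` and `4, 5, 6` and `7` attached to `0`. -/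
def affineE7 : Matrix (Fin 8) (Fin 8) ℕ :=
  graphOf 8 fun i j => (i, j) ∈ [(0, 1), (1, 2), (2, 3), (0, 4), (4, 5), (5, 6), (0, 7)]

/-- `Ẽ 8`: arms `1, 2, 3, 4, 5` and `6, 7` and `8` attached to `0`. -/
def affineE8 : Matrix (Fin 9) (Fin 9) ℕ :=
  graphOf 9 fun i j =>
    (i, j) ∈ [(0, 1), (1, 2), (2, 3), (3, 4), (4, 5), (0, 6), (6, 7), (0, 8)]

/-! ### The list -/

/-- An entry of the list: a `rows × cols` matrix, the vectors of dimensions for `m = 1` (they are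
`(m rowDim, m colDim)` in general), and the corresponding Dynkin diagram. -/
structure ListEntry where
  rows : ℕ
  cols : ℕ
  mat : Matrix (Fin rows) (Fin cols) ℕ
  rowDim : Fin rows → ℕ
  colDim : Fin cols → ℕ
  vertices : ℕ
  diagram : Matrix (Fin vertices) (Fin vertices) ℕ

/-- The `r × s` matrix of zeros and ones whose ones are at the places `(i, j)`, counted from `1`,
that satisfy `P i j`. -/
def zeroOne (r s : ℕ) (P : ℕ → ℕ → Prop) [DecidableRel P] : Matrix (Fin r) (Fin s) ℕ :=
  fun i j => if P (i.val + 1) (j.val + 1) then 1 else 0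

/-- Type `Ã 1`. -/
def entryA1 : ListEntry where
  rows := 1
  cols := 1
  mat := !![2]
  rowDim := ![1]
  colDim := ![1]
  vertices := 2
  diagram := affineA 1

/-- Type `Ã (2k - 1)`, for `k ≥ 2`: ones at `(i, i)` and `(i, i + 1)`, indices modulo `k`. -/
def entryA (k : ℕ) : ListEntry where
  rows := k
  cols := k
  mat := zeroOne k k fun i j => j = i ∨ j ≡ i + 1 [MOD k]
  rowDim := fun _ => 1
  colDim := fun _ => 1
  vertices := 2 * k - 1 + 1
  diagram := affineA (2 * k - 1)

/-- Type `Ẽ 6`. -/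
def entryE6 : ListEntry where
  rows := 3
  cols := 4
  mat := !![1, 1, 0, 0; 1, 0, 1, 0; 1, 0, 0, 1]
  rowDim := ![2, 2, 2]
  colDim := ![3, 1, 1, 1]
  vertices := 7
  diagram := affineE6

/-- Type `D̃ 4`. -/
def entryD4 : ListEntry where
  rows := 1
  cols := 4
  mat := !![1, 1, 1, 1]
  rowDim := ![2]
  colDim := ![1, 1, 1, 1]
  vertices := 5
  diagram := affineD 4

/-- Type `D̃ (2k)`, for `k ≥ 3`: row `1` has ones in columns `1, 2, 3`, row `i` has ones in columns
`i + 1, i + 2` for `2 ≤ i ≤ k - 2`, and row `k - 1` has ones in columns `k, k + 1, k + 2`. -/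
def entryDEven (k : ℕ) : ListEntry where
  rows := k - 1
  cols := k + 2
  mat := zeroOne (k - 1) (k + 2) fun i j =>
    (i = 1 ∧ (j = 1 ∨ j = 2 ∨ j = 3)) ∨
    (2 ≤ i ∧ i + 2 ≤ k ∧ (j = i + 1 ∨ j = i + 2)) ∨
    (i + 1 = k ∧ (j = k ∨ j = k + 1 ∨ j = k + 2))
  rowDim := fun _ => 2
  colDim := fun j => if 3 ≤ j.val + 1 ∧ j.val + 1 ≤ k then 2 else 1
  vertices := 2 * k + 1
  diagram := affineD (2 * k)

/-- Type `D̃ (2k - 1)`, for `k ≥ 3`: row `1` has ones in columns `1, 2, 3`, row `i` has ones in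
columns `i + 1, i + 2` for `2 ≤ i ≤ k - 2`, and rows `k - 1` and `k` have a one in column `k`. -/
def entryDOdd (k : ℕ) : ListEntry where
  rows := k
  cols := k
  mat := zeroOne k k fun i j =>
    (i = 1 ∧ (j = 1 ∨ j = 2 ∨ j = 3)) ∨
    (2 ≤ i ∧ i + 2 ≤ k ∧ (j = i + 1 ∨ j = i + 2)) ∨
    ((i + 1 = k ∨ i = k) ∧ j = k)
  rowDim := fun i => if i.val + 1 ≤ k - 2 then 2 else 1
  colDim := fun j => if 3 ≤ j.val + 1 then 2 else 1
  vertices := 2 * k - 1 + 1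
  diagram := affineD (2 * k - 1)

/-- Type `Ẽ 7`. -/
def entryE7 : ListEntry where
  rows := 3
  cols := 5
  mat := !![1, 1, 0, 0, 0; 0, 1, 1, 1, 0; 0, 0, 0, 1, 1]
  rowDim := ![2, 4, 2]
  colDim := ![1, 3, 2, 3, 1]
  vertices := 8
  diagram := affineE7

/-- Type `Ẽ 8`. -/
def entryE8 : ListEntry where
  rows := 4
  cols := 5
  mat := !![1, 0, 0, 0, 0; 1, 1, 1, 0, 0; 0, 0, 1, 1, 0; 0, 0, 0, 1, 1]
  rowDim := ![2, 6, 4, 2]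
  colDim := ![4, 3, 5, 3, 1]
  vertices := 9
  diagram := affineE8

/-- The entries of the list. -/
def IsListed (E : ListEntry) : Prop :=
  E = entryA1 ∨ (∃ k, 2 ≤ k ∧ E = entryA k) ∨ E = entryE6 ∨ E = entryD4 ∨
    (∃ k, 3 ≤ k ∧ E = entryDEven k) ∨ (∃ k, 3 ≤ k ∧ E = entryDOdd k) ∨ E = entryE7 ∨ E = entryE8

/-- After a permutation of rows and a permutation of columns, `a` is the matrix of the entry `E`,
and the vectors of dimensions attached to the rows and columns are `c` times those of `E`. -/
def Matches (E : ListEntry) (c : ℕ) {r s : ℕ} (a : Matrix (Fin r) (Fin s) ℕ)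
    (rowDim : Fin r → ℕ) (colDim : Fin s → ℕ) : Prop :=
  ∃ (σ : Fin r ≃ Fin E.rows) (τ : Fin s ≃ Fin E.cols),
    (∀ i j, a i j = E.mat (σ i) (τ j)) ∧
    (∀ i, rowDim i = c * E.rowDim (σ i)) ∧ (∀ j, colDim j = c * E.colDim (τ j))

/-- The bipartite diagram with vertices the rows and the columns of `a`, and `a i j` edges between
row `i` and column `j`, is isomorphic to the diagram of the entry `E`. -/
def HasDiagram (E : ListEntry) {r s : ℕ} (a : Matrix (Fin r) (Fin s) ℕ) : Prop :=
  ∃ e : Fin r ⊕ Fin s ≃ Fin E.vertices, ∀ x y,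
    Matrix.fromBlocks 0 a a.transpose 0 x y = E.diagram (e x) (e y)

end PM

namespace PM

/-! ### From a weak PM-structure to linear equations on the dimensions, and connectedness of the
diagram. -/

section Algebra

open Module

/-! Both `A` and `B` are Lagrangian in `L`. The central idempotent of the block `End(V_i)` acts on
`L` as a projection that is self-adjoint against `A`, so its image, of dimension `m_i ∑ a_ij n_j`,
is twice as large as its image on `A`, of dimension `m_i ^ 2`. Hence `∑ a_ij n_j = 2 m_i`
(`sum_row`), and symmetrically for columns (`sum_col`). So the dimensions form a positive vector
killed by the Cartan matrix `2 - M` of the bipartite diagram `M`. A union of connected components of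
`M` would split `L`, so indecomposability makes `M` connected.

The rest is the classification of connected bipartite diagrams with a positive null vector. Pairing
null vectors against each other shows that such a diagram has no proper subdiagram carrying a
positive subharmonic vector (`bijective_of_le`), and that its null vector is unique up to a factor
(`eq_mul`). Every listed diagram carries such a vector (`IsListed.isAffine`), so it suffices to find
one listed diagram inside `M` (`hasListedSubdiagram`): a multiple edge, an even cycle, a vertex of
degree four, two branch vertices joined by a path, or a star with three arms whose lengths are
controlled by the null vector. Finally, an isomorphism of connected bipartite diagrams preserves or
exchanges the two sides, which accounts for the transposition. -/

theorem finrank_range_eq_of_surjective {K U V W : Type*} [Field K] [AddCommGroup U] [Module K U]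
    [AddCommGroup V] [Module K V] [AddCommGroup W] [Module K W] [FiniteDimensional K U]
    (f : U →ₗ[K] V) (g : U →ₗ[K] W) (hg : Function.Surjective g) (h : ∀ u, f u = 0 ↔ g u = 0) :
    finrank K (LinearMap.range f) = finrank K W := by
  have hk : LinearMap.ker f = LinearMap.ker g := by ext u; simp [h]
  have h₁ := f.finrank_range_add_finrank_ker
  have h₂ := g.finrank_range_add_finrank_ker
  rw [LinearMap.range_eq_top.2 hg, finrank_top] at h₂
  rw [hk] at h₁
  omega

theorem mul_comm_of_apply_zero_or_one {ι R : Type*} {M : ι → Type*} [Ring R] [∀ i, Ring (M i)]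
    {F : Type*} [EquivLike F R (∀ i, M i)] [RingEquivClass F R (∀ i, M i)] (φ : F) {e : R}
    (he : ∀ i, φ e i = 0 ∨ φ e i = 1) (x : R) : e * x = x * e := by
  apply EquivLike.injective φ
  ext i
  rw [map_mul, map_mul, Pi.mul_apply, Pi.mul_apply]
  rcases he i with h | h <;> simp [h]

theorem mul_self_of_apply_zero_or_one {ι R : Type*} {M : ι → Type*} [Ring R] [∀ i, Ring (M i)]
    {F : Type*} [EquivLike F R (∀ i, M i)] [RingEquivClass F R (∀ i, M i)] (φ : F) {e : R}
    (he : ∀ i, φ e i = 0 ∨ φ e i = 1) : e * e = e := by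
  apply EquivLike.injective φ
  ext i
  rw [map_mul, Pi.mul_apply]
  rcases he i with h | h <;> simp [h]

theorem pi_single_apply_zero_or_one {ι : Type*} [DecidableEq ι] {M : ι → Type*}
    [∀ i, Ring (M i)] (i k : ι) :
    (Pi.single i 1 : ∀ i, M i) k = 0 ∨ (Pi.single i 1 : ∀ i, M i) k = 1 := by
  by_cases hk : k = i
  · subst hk; simp
  · simp [hk]

/-- A Lagrangian subspace meets the range of a compatible idempotent in half of its dimension. -/
theorem finrank_range_eq_two_mul {K L : Type*} [Field K] [AddCommGroup L] [Module K L]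
    [FiniteDimensional K L] (β : LinearMap.BilinForm K L) (hs : β.IsSymm) (hn : β.Nondegenerate)
    (U : Submodule K L) (hU : ∀ x ∈ U, ∀ y ∈ U, β x y = 0) (hd : finrank K L = 2 * finrank K U)
    (P : L →ₗ[K] L) (hP : ∀ v, P (P v) = P v) (hPU : ∀ u ∈ U, P u ∈ U)
    (hadj : ∀ v, ∀ u ∈ U, β (P v) u = β v (P u)) :
    finrank K (LinearMap.range P) = 2 * finrank K (U.map P) := by
  have hs' : ∀ v w, β v w = β w v := fun v w => hs.eq v w
  have horth := fun W : Submodule K L => LinearMap.BilinForm.finrank_orthogonal hn W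
  have hUle : U ≤ β.orthogonal U := fun x hx y hy => hU y hy x hx
  have hUeq : U = β.orthogonal U := by
    apply Submodule.eq_of_le_of_finrank_eq hUle
    rw [horth U]; omega
  -- As `U` is its own orthogonal, adjointness gives `(P U)^⊥ = P⁻¹ U`. Moreover `P` maps `P⁻¹ U`
  -- onto `P U` with kernel all of `ker P`, so comparing dimensions yields the factor two.
  have hcomap : β.orthogonal (U.map P) = U.comap P := by
    ext v
    rw [Submodule.mem_comap, hUeq, LinearMap.BilinForm.mem_orthogonal_iff,
      LinearMap.BilinForm.mem_orthogonal_iff, ← hUeq]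
    constructor
    · intro h u hu
      have := h (P u) ⟨u, hu, rfl⟩
      change β u (P v) = 0
      rw [hs', hadj v u hu, ← hs']
      exact this
    · rintro h _ ⟨u, hu, rfl⟩
      have := h u hu
      change β (P u) v = 0
      rw [hs', ← hadj v u hu, ← hs']
      exact this
  have h₁ := horth (U.map P)
  have h₂ := P.finrank_range_add_finrank_ker
  have h₃ := (P.domRestrict (U.comap P)).finrank_range_add_finrank_ker
  have h₄ : LinearMap.range (P.domRestrict (U.comap P)) = U.map P := by
    ext x
    constructor
    · rintro ⟨⟨v, hv⟩, rfl⟩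
      exact ⟨P v, hv, hP v⟩
    · rintro ⟨u, hu, rfl⟩
      exact ⟨⟨u, hPU u hu⟩, rfl⟩
  have h₅ : finrank K (LinearMap.ker (P.domRestrict (U.comap P))) =
      finrank K (LinearMap.ker P) := by
    have : (LinearMap.ker (P.domRestrict (U.comap P))).map (U.comap P).subtype =
        LinearMap.ker P := by
      ext v
      constructor
      · rintro ⟨w, hw, rfl⟩
        exact hw
      · intro hv
        have hv' : P v = 0 := hv
        exact ⟨⟨v, by simp [Submodule.mem_comap, hv']⟩, hv, rfl⟩
    rw [← this]
    exact (LinearEquiv.finrank_eq (Submodule.equivMapOfInjective _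
      (Submodule.injective_subtype _) _))
  have h₆ := Submodule.finrank_le (U.map P)
  rw [hcomap] at h₁
  rw [h₄, h₅] at h₃
  omega

variable {A B L : Type*} [Ring A] [Algebra ℂ A] [Ring B] [Algebra ℂ B]
  [AddCommGroup L] [Module ℂ L] [Module B L] [Module Aᵐᵒᵖ L]
  [IsScalarTower ℂ B L] [IsScalarTower ℂ Aᵐᵒᵖ L] [SMulCommClass B Aᵐᵒᵖ L] {size : ℕ}

/-- Isotropy bounds `dim A` and `dim B` by half of `dim L`. Since the intersection and the quotient
by the sum have the same dimension, `dim A + dim B = dim L`, so both bounds are attained. -/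
theorem WeakPMStructure.finrank_eq [FiniteDimensional ℂ L] (S : WeakPMStructure A B L size) :
    finrank ℂ L = 2 * finrank ℂ (LinearMap.range S.inclA) ∧
      finrank ℂ L = 2 * finrank ℂ (LinearMap.range S.inclB) := by
  have hA : LinearMap.range S.inclA ≤ S.form.orthogonal (LinearMap.range S.inclA) := by
    rintro _ ⟨x, rfl⟩ _ ⟨y, rfl⟩
    exact S.form_A_A y x
  have hB : LinearMap.range S.inclB ≤ S.form.orthogonal (LinearMap.range S.inclB) := by
    rintro _ ⟨x, rfl⟩ _ ⟨y, rfl⟩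
    exact S.form_B_B y x
  have h₁ := Submodule.finrank_mono hA
  have h₂ := Submodule.finrank_mono hB
  rw [LinearMap.BilinForm.finrank_orthogonal S.form_nondegenerate] at h₁ h₂
  have h₃ := Submodule.finrank_sup_add_finrank_inf_eq (LinearMap.range S.inclA)
    (LinearMap.range S.inclB)
  have h₄ := Submodule.finrank_quotient_add_finrank
    (LinearMap.range S.inclA ⊔ LinearMap.range S.inclB)
  rw [S.finrank_quotient] at h₄
  rw [S.finrank_inf] at h₃
  omega

variable {r s : ℕ}
  {V : Fin r → Type*} [∀ i, AddCommGroup (V i)] [∀ i, Module ℂ (V i)]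
  {W : Fin s → Type*} [∀ j, AddCommGroup (W j)] [∀ j, Module ℂ (W j)]

theorem rTensor_dualMap_one (V W : Type*) [AddCommGroup V] [Module ℂ V] [AddCommGroup W]
    [Module ℂ W] : ((1 : Module.End ℂ V).dualMap).rTensor W = LinearMap.id := by
  have h : (1 : Module.End ℂ V).dualMap = LinearMap.id := LinearMap.dualMap_id
  rw [h, LinearMap.rTensor_id]

theorem rTensor_dualMap_zero (V W : Type*) [AddCommGroup V] [Module ℂ V] [AddCommGroup W]
    [Module ℂ W] : ((0 : Module.End ℂ V).dualMap).rTensor W = 0 := by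
  have h : (0 : Module.End ℂ V).dualMap = 0 := by ext; simp
  rw [h, LinearMap.rTensor_zero]

theorem WeakPMStructure.sum_row [FiniteDimensional ℂ L] [∀ i, FiniteDimensional ℂ (V i)]
    [∀ i, Nontrivial (V i)] [∀ j, FiniteDimensional ℂ (W j)]
    (S : WeakPMStructure A B L size)
    {φ : A ≃ₐ[ℂ] (∀ i, Module.End ℂ (V i))} {ψ : B ≃ₐ[ℂ] (∀ j, Module.End ℂ (W j))}
    {a : Matrix (Fin r) (Fin s) ℕ} (ha : IsMatrixOfMultiplicities L φ ψ a) (i : Fin r) :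
    ∑ j, a i j * finrank ℂ (W j) = 2 * finrank ℂ (V i) := by
  classical
  obtain ⟨Φ, hΦ, -⟩ := ha
  obtain ⟨e, hφe⟩ := φ.surjective (Pi.single i 1)
  have he : ∀ k, φ e k = 0 ∨ φ e k = 1 := by
    intro k; rw [hφe]; exact pi_single_apply_zero_or_one i k
  have hcomm := mul_comm_of_apply_zero_or_one φ he
  have hee := mul_self_of_apply_zero_or_one φ he
  let P : L →ₗ[ℂ] L := Algebra.lsmul ℂ ℂ L (MulOpposite.op e)
  have hPdef : ∀ v, P v = MulOpposite.op e • v := fun v => rfl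
  have hPA : ∀ x : A, P (S.inclA x) = S.inclA (x * e) := fun x => (S.inclA_mul x e).symm
  have key := finrank_range_eq_two_mul S.form S.form_symm S.form_nondegenerate
    (LinearMap.range S.inclA) (by rintro _ ⟨x, rfl⟩ _ ⟨y, rfl⟩; exact S.form_A_A x y)
    S.finrank_eq.1 P (fun v => by rw [hPdef, hPdef, smul_smul, ← MulOpposite.op_mul, hee])
    (by rintro _ ⟨x, rfl⟩; exact ⟨x * e, (hPA x).symm⟩)
    (by
      rintro v _ ⟨x, rfl⟩
      -- `form_mul_A` moves a left factor across the form, while `P` multiplies by `e` on the right: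
      -- centrality of `e` is what makes `P` self-adjoint against `A`.
      rw [hPA, ← hcomm, S.form_mul_A, hPdef])
  let Q : L →ₗ[ℂ] (∀ j, Fin (a i j) → Module.Dual ℂ (V i) ⊗[ℂ] W j) :=
    LinearMap.proj i ∘ₗ Φ.toLinearMap
  have h₁ := finrank_range_eq_of_surjective P Q
    ((Function.surjective_eval i).comp Φ.surjective) (by
      intro v
      rw [← map_eq_zero_iff Φ Φ.injective]
      constructor
      · intro h
        ext1 j
        ext1 t
        have h₁ := hΦ e v i j t
        rw [← hPdef, h, hφe, Pi.single_eq_same, rTensor_dualMap_one] at h₁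
        exact h₁.symm
      · intro h
        ext1 k
        ext1 j
        ext1 t
        rw [hPdef, hΦ, hφe]
        by_cases hk : k = i
        · subst hk
          have : Φ v k j t = 0 := congrFun (congrFun h j) t
          rw [this, map_zero]; rfl
        · rw [Pi.single_eq_of_ne hk, rTensor_dualMap_zero]; rfl)
  have : FiniteDimensional ℂ A := FiniteDimensional.of_injective S.inclA S.inclA_injective
  let Q' : A →ₗ[ℂ] Module.End ℂ (V i) := LinearMap.proj i ∘ₗ φ.toLinearMap
  have h₂ := finrank_range_eq_of_surjective (P ∘ₗ S.inclA)
    Q' ((Function.surjective_eval i).comp φ.surjective) (by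
      intro x
      rw [LinearMap.comp_apply, hPA, map_eq_zero_iff S.inclA S.inclA_injective,
        ← map_eq_zero_iff φ φ.injective, map_mul, hφe]
      constructor
      · intro h
        have := congrFun h i
        change φ x i = 0
        simpa using this
      · intro h
        have h : φ x i = 0 := h
        ext1 k
        by_cases hk : k = i
        · subst hk; simp [h]
        · simp [hk])
  rw [LinearMap.range_comp] at h₂
  rw [h₁, h₂] at key
  simp only [Module.finrank_pi_fintype, Module.finrank_tensorProduct, Module.finrank_linearMap,
    Module.finrank_self, Finset.sum_const, Finset.card_univ, Fintype.card_fin,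
    smul_eq_mul] at key
  have hpos : 0 < finrank ℂ (V i) := Module.finrank_pos
  apply Nat.eq_of_mul_eq_mul_left hpos
  rw [Finset.mul_sum]
  calc _ = _ := Finset.sum_congr rfl fun j _ => by ring
    _ = _ := key
    _ = _ := by ring

theorem WeakPMStructure.sum_col [FiniteDimensional ℂ L] [∀ i, FiniteDimensional ℂ (V i)]
    [∀ j, FiniteDimensional ℂ (W j)] [∀ j, Nontrivial (W j)]
    (S : WeakPMStructure A B L size)
    {φ : A ≃ₐ[ℂ] (∀ i, Module.End ℂ (V i))} {ψ : B ≃ₐ[ℂ] (∀ j, Module.End ℂ (W j))}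
    {a : Matrix (Fin r) (Fin s) ℕ} (ha : IsMatrixOfMultiplicities L φ ψ a) (j : Fin s) :
    ∑ i, a i j * finrank ℂ (V i) = 2 * finrank ℂ (W j) := by
  classical
  obtain ⟨Φ, -, hΦ⟩ := ha
  obtain ⟨e, hψe⟩ := ψ.surjective (Pi.single j 1)
  have he : ∀ k, ψ e k = 0 ∨ ψ e k = 1 := by
    intro k; rw [hψe]; exact pi_single_apply_zero_or_one j k
  have hcomm := mul_comm_of_apply_zero_or_one ψ he
  have hee := mul_self_of_apply_zero_or_one ψ he
  let P : L →ₗ[ℂ] L := Algebra.lsmul ℂ ℂ L e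
  have hPdef : ∀ v, P v = e • v := fun v => rfl
  have hPB : ∀ x : B, P (S.inclB x) = S.inclB (e * x) := fun x => (S.inclB_mul e x).symm
  have hsymm : ∀ v w, S.form v w = S.form w v := fun v w => S.form_symm.eq v w
  have key := finrank_range_eq_two_mul S.form S.form_symm S.form_nondegenerate
    (LinearMap.range S.inclB) (by rintro _ ⟨x, rfl⟩ _ ⟨y, rfl⟩; exact S.form_B_B x y)
    S.finrank_eq.2 P (fun v => by rw [hPdef, hPdef, smul_smul, hee])
    (by rintro _ ⟨x, rfl⟩; exact ⟨e * x, (hPB x).symm⟩)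
    (by
      rintro v _ ⟨x, rfl⟩
      rw [hPB, hcomm, hsymm, hsymm v, S.form_mul_B, hPdef])
  let Q : L →ₗ[ℂ] (∀ i, Fin (a i j) → Module.Dual ℂ (V i) ⊗[ℂ] W j) :=
    LinearMap.pi fun i => LinearMap.proj j ∘ₗ LinearMap.proj i ∘ₗ Φ.toLinearMap
  have hQ : ∀ v i, Q v i = Φ v i j := fun v i => rfl
  have h₁ := finrank_range_eq_of_surjective P Q (by
      intro w
      obtain ⟨v, hv⟩ := Φ.surjective fun i =>
        Pi.single (M := fun j => Fin (a i j) → Module.Dual ℂ (V i) ⊗[ℂ] W j) j (w i)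
      refine ⟨v, ?_⟩
      ext1 i
      rw [hQ]
      exact (congrFun (congrFun hv i) j).trans (Pi.single_eq_same _ _)) (by
      intro v
      rw [← map_eq_zero_iff Φ Φ.injective]
      constructor
      · intro h
        ext1 i
        ext1 t
        have h₁ := hΦ e v i j t
        rw [← hPdef, h, hψe, Pi.single_eq_same, Module.End.one_eq_id, LinearMap.lTensor_id] at h₁
        exact h₁.symm
      · intro h
        ext1 i
        ext1 k
        ext1 t
        rw [hPdef, hΦ, hψe]
        by_cases hk : k = j
        · subst hk
          have : Φ v i k t = 0 := congrFun (congrFun h i) t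
          rw [this, map_zero]; rfl
        · rw [Pi.single_eq_of_ne hk, LinearMap.lTensor_zero]; rfl)
  have : FiniteDimensional ℂ B := FiniteDimensional.of_injective S.inclB S.inclB_injective
  let Q' : B →ₗ[ℂ] Module.End ℂ (W j) := LinearMap.proj j ∘ₗ ψ.toLinearMap
  have h₂ := finrank_range_eq_of_surjective (P ∘ₗ S.inclB)
    Q' ((Function.surjective_eval j).comp ψ.surjective) (by
      intro x
      rw [LinearMap.comp_apply, hPB, map_eq_zero_iff S.inclB S.inclB_injective,
        ← map_eq_zero_iff ψ ψ.injective, map_mul, hψe]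
      constructor
      · intro h
        have := congrFun h j
        change ψ x j = 0
        simpa using this
      · intro h
        have h : ψ x j = 0 := h
        ext1 k
        by_cases hk : k = j
        · subst hk; simp [h]
        · simp [hk])
  rw [LinearMap.range_comp] at h₂
  rw [h₁, h₂] at key
  simp only [Module.finrank_pi_fintype, Module.finrank_tensorProduct, Module.finrank_linearMap,
    Module.finrank_self, Finset.sum_const, Finset.card_univ, Fintype.card_fin,
    smul_eq_mul] at key
  have hpos : 0 < finrank ℂ (W j) := Module.finrank_pos
  apply Nat.eq_of_mul_eq_mul_left hpos
  rw [Finset.mul_sum]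
  calc _ = _ := Finset.sum_congr rfl fun i _ => by ring
    _ = _ := key
    _ = _ := by ring

/-- The diagram of an indecomposable weak PM-structure is connected. -/
theorem WeakPMStructure.IsIndecomposable.connected [∀ i, Nontrivial (V i)]
    [∀ j, Nontrivial (W j)] {S : WeakPMStructure A B L size} (hS : S.IsIndecomposable)
    {φ : A ≃ₐ[ℂ] (∀ i, Module.End ℂ (V i))} {ψ : B ≃ₐ[ℂ] (∀ j, Module.End ℂ (W j))}
    {a : Matrix (Fin r) (Fin s) ℕ} (ha : IsMatrixOfMultiplicities L φ ψ a)
    (R : Fin r → Prop) (C : Fin s → Prop) (hRC : ∀ i j, a i j ≠ 0 → (R i ↔ C j))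
    (hne : (∃ i, R i) ∨ ∃ j, C j) : (∀ i, R i) ∧ ∀ j, C j := by
  classical
  obtain ⟨Φ, hΦA, hΦB⟩ := ha
  obtain ⟨e, hφe⟩ := φ.surjective fun i => if R i then 1 else 0
  obtain ⟨f, hψf⟩ := ψ.surjective fun j => if C j then 1 else 0
  have he : ∀ k, φ e k = 0 ∨ φ e k = 1 := by
    intro k; rw [hφe]; by_cases h : R k <;> simp [h]
  have hf : ∀ k, ψ f k = 0 ∨ ψ f k = 1 := by
    intro k; rw [hψf]; by_cases h : C k <;> simp [h]
  have hecomm := mul_comm_of_apply_zero_or_one φ he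
  have hee := mul_self_of_apply_zero_or_one φ he
  have hfcomm := mul_comm_of_apply_zero_or_one ψ hf
  let P : L →ₗ[ℂ] L := Algebra.lsmul ℂ ℂ L (MulOpposite.op e)
  have hPe : ∀ v, P v = MulOpposite.op e • v := fun v => rfl
  -- On a summand that really occurs, `hRC` makes `e` and `f` act by the same scalar, `0` or `1`. So
  -- one projection comes from both algebras, and its range and kernel are compatible with both.
  have hPf : ∀ v, P v = f • v := by
    intro v
    apply Φ.injective
    ext1 i
    ext1 j
    ext1 t
    rw [hPe, hΦA, hΦB, hφe, hψf]
    have hij : R i ↔ C j := hRC i j fun h => by rw [h] at t; exact t.elim0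
    by_cases hR : R i
    · simp only [if_pos hR, if_pos (hij.1 hR)]
      rw [rTensor_dualMap_one, Module.End.one_eq_id, LinearMap.lTensor_id]
    · simp only [if_neg hR, if_neg (mt hij.2 hR)]
      rw [rTensor_dualMap_zero, LinearMap.lTensor_zero]
  have hPA : ∀ x : A, P (S.inclA x) = S.inclA (x * e) := fun x => (S.inclA_mul x e).symm
  have hPB : ∀ x : B, P (S.inclB x) = S.inclB (f * x) := fun x => by
    rw [hPf, S.inclB_mul]
  have hPP : ∀ v, P (P v) = P v := fun v => by
    rw [hPe, hPe, smul_smul, ← MulOpposite.op_mul, hee]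
  by_contra hall
  apply hS
  have hmem : ∀ v, v ∈ LinearMap.range P ↔ P v = v :=
    fun v => ⟨by rintro ⟨w, rfl⟩; exact hPP w, fun h => ⟨v, h⟩⟩
  -- A zero range would force `e = f = 0`, against `hne`; a zero kernel would force `e = f = 1`,
  -- against `hall`.
  refine ⟨LinearMap.range P, LinearMap.ker P, ?_, ?_, ?_, ?_, ?_, ?_, ?_, ?_, ?_⟩
  · intro h
    rw [LinearMap.range_eq_bot] at h
    have h₁ : e = 0 := by
      apply S.inclA_injective
      rw [map_zero, ← one_mul e, ← hPA, h, LinearMap.zero_apply]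
    have h₂ : f = 0 := by
      apply S.inclB_injective
      rw [map_zero, ← mul_one f, ← hPB, h, LinearMap.zero_apply]
    rcases hne with ⟨i, hi⟩ | ⟨j, hj⟩
    · have := congrFun hφe i
      simp [h₁, hi] at this
    · have := congrFun hψf j
      simp [h₂, hj] at this
  · intro h
    rw [LinearMap.ker_eq_bot] at h
    have h₁ : e = 1 := by
      apply S.inclA_injective
      apply h
      rw [hPA, hPA, hee, one_mul]
    have h₂ : f = 1 := by
      apply S.inclB_injective
      apply h
      rw [hPB, hPB, mul_self_of_apply_zero_or_one ψ hf, mul_one]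
    apply hall
    constructor
    · intro i
      by_contra hi
      have := congrFun hφe i
      simp [h₁, hi] at this
    · intro j
      by_contra hj
      have := congrFun hψf j
      simp [h₂, hj] at this
  · exact LinearMap.IsIdempotentElem.isCompl (LinearMap.ext hPP)
  · refine fun x => ⟨x * e, x - x * e, by abel, ⟨S.inclA x, hPA x⟩, ?_⟩
    rw [LinearMap.mem_ker, hPA, sub_mul, mul_assoc, hee, sub_self, map_zero]
  · refine fun x => ⟨f * x, x - f * x, by abel, ⟨S.inclB x, hPB x⟩, ?_⟩
    rw [LinearMap.mem_ker, hPB, mul_sub, ← mul_assoc, mul_self_of_apply_zero_or_one ψ hf,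
      sub_self, map_zero]
  · intro x hx
    rw [hmem, hPA] at hx
    have hx := S.inclA_injective hx
    constructor
    · intro v _
      refine ⟨MulOpposite.op x • v, ?_⟩
      rw [hPe, smul_smul, ← MulOpposite.op_mul, hx]
    · intro v hv
      rw [← hx, ← hecomm, MulOpposite.op_mul, mul_smul, ← hPe, LinearMap.mem_ker.1 hv, smul_zero]
  · intro x hx
    rw [LinearMap.mem_ker, hPA, map_eq_zero_iff S.inclA S.inclA_injective] at hx
    constructor
    · intro v hv
      rw [← (hmem v).1 hv, hPe, smul_smul, ← MulOpposite.op_mul, hecomm, hx, MulOpposite.op_zero,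
        zero_smul]
    · intro v _
      rw [LinearMap.mem_ker, hPe, smul_smul, ← MulOpposite.op_mul, hx, MulOpposite.op_zero,
        zero_smul]
  · intro x hx
    rw [hmem, hPB] at hx
    have hx := S.inclB_injective hx
    constructor
    · intro v _
      refine ⟨x • v, ?_⟩
      rw [hPf, smul_smul, hx]
    · intro v hv
      rw [← hx, hfcomm, mul_smul, ← hPf, LinearMap.mem_ker.1 hv, smul_zero]
  · intro x hx
    rw [LinearMap.mem_ker, hPB, map_eq_zero_iff S.inclB S.inclB_injective] at hx
    constructor
    · intro v hv
      rw [← (hmem v).1 hv, hPf, smul_smul, ← hfcomm, hx, zero_smul]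
    · intro v _
      rw [LinearMap.mem_ker, hPf, smul_smul, hx, zero_smul]

end Algebra

/-! ### Rigidity of positive null vectors. -/

section NullVector

variable {X Y : Type*} [Fintype X] [Fintype Y]

/-- `M` is the matrix of edge multiplicities of a connected diagram, and `d` is a positive vector
that the Cartan matrix `2 - M` annihilates. -/
structure IsNullVector (M : X → X → ℕ) (d : X → ℕ) : Prop where
  symm : ∀ x y, M x y = M y x
  pos : ∀ x, 0 < d x
  sum_eq : ∀ x, ∑ y, M x y * d y = 2 * d x
  connected : ∀ P : X → Prop, (∀ x y, M x y ≠ 0 → P x → P y) → (∃ x, P x) → ∀ x, P x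

variable {M : X → X → ℕ} {d : X → ℕ} {N : Y → Y → ℕ} {δ : Y → ℕ}

/-- By symmetry of `N`, the pairings of `δ` with `N d` and of `d` with `N δ` agree. The first is at
most, and the second at least, twice the pairing of `δ` with `d`; positivity turns the resulting
equality of sums into equality at every vertex. -/
theorem IsNullVector.sum_comp_eq (h : IsNullVector M d) (hN : ∀ y z, N y z = N z y)
    (hδ : ∀ y, 0 < δ y) (hsub : ∀ y, 2 * δ y ≤ ∑ z, N y z * δ z)
    {ι : Y → X} (hι : Function.Injective ι) (hle : ∀ y z, N y z ≤ M (ι y) (ι z)) :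
    (∀ y, ∑ z, N y z * d (ι z) = 2 * d (ι y)) ∧ ∀ y, ∑ z, N y z * δ z = 2 * δ y := by
  classical
  have hT : ∀ y, ∑ z, N y z * d (ι z) ≤ 2 * d (ι y) := by
    intro y
    rw [← h.sum_eq]
    calc ∑ z, N y z * d (ι z) ≤ ∑ z, M (ι y) (ι z) * d (ι z) :=
          Finset.sum_le_sum fun z _ => Nat.mul_le_mul_right _ (hle y z)
      _ = ∑ x ∈ Finset.univ.image ι, M (ι y) x * d x :=
          by rw [Finset.sum_image fun _ _ _ _ e => hι e]
      _ ≤ _ := Finset.sum_le_sum_of_subset (Finset.subset_univ _)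
  have hswap : ∑ y, δ y * ∑ z, N y z * d (ι z) = ∑ y, d (ι y) * ∑ z, N y z * δ z := by
    simp_rw [Finset.mul_sum]
    rw [Finset.sum_comm]
    refine Finset.sum_congr rfl fun y _ => Finset.sum_congr rfl fun z _ => ?_
    rw [hN]
    ring
  have h₁ : ∑ y, δ y * ∑ z, N y z * d (ι z) ≤ ∑ y, δ y * (2 * d (ι y)) :=
    Finset.sum_le_sum fun y _ => Nat.mul_le_mul_left _ (hT y)
  have h₂ : ∑ y, d (ι y) * (2 * δ y) ≤ ∑ y, d (ι y) * ∑ z, N y z * δ z :=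
    Finset.sum_le_sum fun y _ => Nat.mul_le_mul_left _ (hsub y)
  have h₃ : ∑ y, δ y * (2 * d (ι y)) = ∑ y, d (ι y) * (2 * δ y) :=
    Finset.sum_congr rfl fun y _ => by ring
  constructor
  · intro y
    have := (Finset.sum_eq_sum_iff_of_le fun y _ => Nat.mul_le_mul_left (δ y) (hT y)).1
      (by omega) y (Finset.mem_univ y)
    exact Nat.eq_of_mul_eq_mul_left (hδ y) this
  · intro y
    have := (Finset.sum_eq_sum_iff_of_le fun y _ => Nat.mul_le_mul_left (d (ι y)) (hsub y)).1
      (by omega) y (Finset.mem_univ y)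
    exact (Nat.eq_of_mul_eq_mul_left (h.pos _) this).symm

/-- A diagram with a positive null vector has no proper subdiagram with a positive subharmonic
vector. -/
theorem IsNullVector.bijective_of_le (h : IsNullVector M d) [Nonempty Y]
    (hN : ∀ y z, N y z = N z y)
    (hδ : ∀ y, 0 < δ y) (hsub : ∀ y, 2 * δ y ≤ ∑ z, N y z * δ z)
    {ι : Y → X} (hι : Function.Injective ι) (hle : ∀ y z, N y z ≤ M (ι y) (ι z)) :
    Function.Bijective ι ∧ ∀ y z, N y z = M (ι y) (ι z) := by
  classical
  have hT := (h.sum_comp_eq hN hδ hsub hι hle).1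
  have h₁ : ∀ y, ∑ z, N y z * d (ι z) ≤ ∑ z, M (ι y) (ι z) * d (ι z) := fun y =>
    Finset.sum_le_sum fun z _ => Nat.mul_le_mul_right _ (hle y z)
  have h₂ : ∀ y, ∑ z, M (ι y) (ι z) * d (ι z) = ∑ x ∈ Finset.univ.image ι, M (ι y) x * d x :=
    fun y => by rw [Finset.sum_image fun _ _ _ _ e => hι e]
  have h₃ : ∀ y, ∑ x ∈ Finset.univ.image ι, M (ι y) x * d x +
      ∑ x ∈ (Finset.univ.image ι)ᶜ, M (ι y) x * d x = 2 * d (ι y) := fun y => by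
    rw [Finset.sum_add_sum_compl, h.sum_eq]
  -- The image of `ι` already uses up the whole of `2 d`, so no edge leaves it; connectedness then
  -- makes `ι` surjective.
  have h₄ : ∀ y x, x ∉ Set.range ι → M (ι y) x = 0 := by
    intro y x hx
    have h0 : ∑ x ∈ (Finset.univ.image ι)ᶜ, M (ι y) x * d x = 0 := by
      have := h₁ y; have := h₂ y; have := h₃ y; have := hT y
      omega
    have := (Finset.sum_eq_zero_iff.1 h0) x (by
      rw [Finset.mem_compl, Finset.mem_image]
      rintro ⟨z, -, hz⟩
      exact hx ⟨z, hz⟩)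
    exact (Nat.mul_eq_zero.1 this).resolve_right (h.pos x).ne'
  refine ⟨⟨hι, ?_⟩, ?_⟩
  · refine h.connected (fun x => ∃ y, ι y = x) ?_ ⟨ι (Classical.arbitrary Y), _, rfl⟩
    rintro _ x hx ⟨y, rfl⟩
    by_contra hxr
    exact hx (h₄ y x hxr)
  · intro y z
    have h5 : ∑ z, N y z * d (ι z) = ∑ z, M (ι y) (ι z) * d (ι z) := by
      have := h₁ y; have := h₂ y; have := h₃ y; have := hT y
      omega
    have := (Finset.sum_eq_sum_iff_of_le fun z _ =>
      Nat.mul_le_mul_right (d (ι z)) (hle y z)).1 h5 z (Finset.mem_univ z)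
    exact Nat.eq_of_mul_eq_mul_right (h.pos _) this

/-- The positive null vector is unique up to a factor. -/
theorem IsNullVector.eq_mul (h : IsNullVector M d)
    (hN : ∀ y z, N y z = N z y)
    (hδ : ∀ y, 0 < δ y) (hsub : ∀ y, 2 * δ y ≤ ∑ z, N y z * δ z)
    {ι : Y → X} (hι : Function.Injective ι) (hle : ∀ y z, N y z ≤ M (ι y) (ι z))
    {y₁ : Y} (hy₁ : δ y₁ = 1) (y : Y) : d (ι y) = d (ι y₁) * δ y := by
  have : Nonempty Y := ⟨y₁⟩
  obtain ⟨hT, hS⟩ := h.sum_comp_eq hN hδ hsub hι hle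
  obtain ⟨hbij, hNM⟩ := h.bijective_of_le hN hδ hsub hι hle
  -- Minimum principle: both vectors are null for `N`, so a vertex where the ratio `d / δ` is
  -- minimal forces the same ratio at its neighbours, and by connectedness everywhere.
  obtain ⟨y₀, hy₀⟩ := Finite.exists_min fun y => (d (ι y) : ℚ) / δ y
  have hmin : ∀ y, d (ι y₀) * δ y ≤ d (ι y) * δ y₀ := by
    intro y
    have := hy₀ y
    rw [div_le_div_iff₀ (by exact_mod_cast hδ y₀) (by exact_mod_cast hδ y)] at this
    exact_mod_cast this
  have hall : ∀ x, ∀ y, ι y = x → d (ι y₀) * δ y = d (ι y) * δ y₀ := by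
    apply h.connected
    · rintro x _ hx hP z rfl
      obtain ⟨y, rfl⟩ := hbij.2 x
      have h₁ := hP y rfl
      have h₂ : ∑ z, N y z * (d (ι y₀) * δ z) = ∑ z, N y z * (d (ι z) * δ y₀) := by
        calc ∑ z, N y z * (d (ι y₀) * δ z) = d (ι y₀) * ∑ z, N y z * δ z := by
              rw [Finset.mul_sum]; exact Finset.sum_congr rfl fun z _ => by ring
          _ = (∑ z, N y z * d (ι z)) * δ y₀ := by rw [hS, hT]; linarith
          _ = _ := by rw [Finset.sum_mul]; exact Finset.sum_congr rfl fun z _ => by ring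
      have h₃ := (Finset.sum_eq_sum_iff_of_le fun z _ =>
        Nat.mul_le_mul_left (N y z) (hmin z)).1 h₂ z (Finset.mem_univ z)
      rw [← hNM] at hx
      exact Nat.eq_of_mul_eq_mul_left (Nat.pos_of_ne_zero hx) h₃
    · refine ⟨ι y₀, fun y hy => ?_⟩
      rw [hι hy]
  have h₁ := hall _ y rfl
  have h₂ := hall _ y₁ rfl
  rw [hy₁, mul_one] at h₂
  apply Nat.eq_of_mul_eq_mul_right (hδ y₀)
  rw [← h₁, h₂]
  ring

end NullVector

/-! ### Each listed diagram is bipartite of the listed shape and carries a subharmonic vector. -/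

section Entries

/-- The bipartite diagram of the matrix of an entry is the diagram of the entry, and the dimensions
form a positive subharmonic vector with an entry `1`. -/
def ListEntry.IsAffine (E : ListEntry) : Prop :=
  ∃ (e : Fin E.rows ⊕ Fin E.cols ≃ Fin E.vertices) (δ : Fin E.vertices → ℕ),
    (∀ x y, Matrix.fromBlocks 0 E.mat E.mat.transpose 0 x y = E.diagram (e x) (e y)) ∧
    (∀ p q, E.diagram p q = E.diagram q p) ∧
    (∀ x, δ (e x) = Sum.elim E.rowDim E.colDim x) ∧ (∀ p, 0 < δ p) ∧ (∃ p, δ p = 1) ∧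
    ∀ p, 2 * δ p ≤ ∑ q, E.diagram p q * δ q

/-- The placement of rows and columns on the diagram is given by two separate maps; disjoint images
and a count make them one bijection, and the remaining conditions are elementary checks. -/
theorem ListEntry.IsAffine.intro {r s n : ℕ} {a : Matrix (Fin r) (Fin s) ℕ} {u : Fin r → ℕ}
    {v : Fin s → ℕ} {D : Matrix (Fin n) (Fin n) ℕ}
    (f : Fin r → Fin n) (g : Fin s → Fin n) (δ : Fin n → ℕ)
    (hcard : r + s = n) (hf : ∀ i j, f i = f j → i = j)
    (hg : ∀ i j, g i = g j → i = j) (hfg : ∀ i j, f i ≠ g j)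
    (hsymm : ∀ p q, D p q = D q p) (hmat : ∀ i j, a i j = D (f i) (g j))
    (hrow : ∀ i j, D (f i) (f j) = 0) (hcol : ∀ i j, D (g i) (g j) = 0)
    (hδf : ∀ i, δ (f i) = u i) (hδg : ∀ j, δ (g j) = v j)
    (hpos : ∀ p, 0 < δ p) (hone : ∃ p, δ p = 1)
    (hsub : ∀ p, 2 * δ p ≤ ∑ q, D p q * δ q) : (ListEntry.mk r s a u v n D).IsAffine := by
  have hb : Function.Bijective (Sum.elim f g) := by
    rw [Fintype.bijective_iff_injective_and_card]
    refine ⟨Function.Injective.sumElim hf hg hfg, ?_⟩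
    simpa using hcard
  refine ⟨Equiv.ofBijective _ hb, δ, ?_, hsymm, ?_, hpos, hone, hsub⟩
  · rintro (i | i) (j | j)
    · simp [hrow]
    · simp [hmat]
    · simp [hmat, hsymm (g i)]
    · simp [hcol]
  · rintro (i | i)
    · simp [hδf]
    · simp [hδg]

theorem isAffine_entryA1 : entryA1.IsAffine := by
  rw [entryA1]
  refine .intro (fun _ => (0 : Fin 2)) (fun _ => (1 : Fin 2)) (fun _ => 1) (by decide) (by decide)
    (by decide) (by decide) ?_ ?_ (by decide) (by decide) (by decide) (by decide) (by decide)
    (by decide) (by decide)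
  all_goals
    intro p q
    fin_cases p <;> fin_cases q <;> rfl

theorem isAffine_entryD4 : entryD4.IsAffine := by
  rw [entryD4]
  refine .intro (![2] : Fin 1 → Fin 5) (![0, 1, 3, 4] : Fin 4 → Fin 5)
    (![1, 1, 2, 1, 1] : Fin 5 → ℕ) (by decide) (by decide)
    (by decide) (by decide) ?_ ?_ (by decide) (by decide) (by decide) (by decide) (by decide)
    (by decide) (by decide)
  all_goals
    intro p q
    fin_cases p <;> fin_cases q <;> rfl

theorem isAffine_entryE6 : entryE6.IsAffine := by
  rw [entryE6]
  refine .intro (![1, 3, 5] : Fin 3 → Fin 7) (![0, 2, 4, 6] : Fin 4 → Fin 7)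
    (![3, 2, 1, 2, 1, 2, 1] : Fin 7 → ℕ) (by decide) (by decide)
    (by decide) (by decide) ?_ ?_ (by decide) (by decide) (by decide) (by decide) (by decide)
    (by decide) (by decide)
  all_goals
    intro p q
    fin_cases p <;> fin_cases q <;> rfl

theorem isAffine_entryE7 : entryE7.IsAffine := by
  rw [entryE7]
  refine .intro (![2, 0, 5] : Fin 3 → Fin 8) (![3, 1, 7, 4, 6] : Fin 5 → Fin 8)
    (![4, 3, 2, 1, 3, 2, 1, 2] : Fin 8 → ℕ) (by decide) (by decide)
    (by decide) (by decide) ?_ ?_ (by decide) (by decide) (by decide) (by decide) (by decide)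
    (by decide) (by decide)
  all_goals
    intro p q
    fin_cases p <;> fin_cases q <;> rfl

theorem isAffine_entryE8 : entryE8.IsAffine := by
  rw [entryE8]
  refine .intro (![7, 0, 2, 4] : Fin 4 → Fin 9) (![6, 8, 1, 3, 5] : Fin 5 → Fin 9)
    (![6, 5, 4, 3, 2, 1, 4, 2, 3] : Fin 9 → ℕ) (by decide) (by decide)
    (by decide) (by decide) ?_ ?_ (by decide) (by decide) (by decide) (by decide) (by decide)
    (by decide) (by decide)
  all_goals
    intro p q
    fin_cases p <;> fin_cases q <;> rfl

theorem mod_eq_ite {x n : ℕ} (hx : x ≤ n) : x % n = if x = n then 0 else x := by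
  split_ifs with h
  · rw [h, Nat.mod_self]
  · exact Nat.mod_eq_of_lt (by omega)

theorem affineA_apply {n : ℕ} (p q : Fin (n + 1)) : affineA n p q =
    (if p.val = n ∧ q.val = 0 ∨ p.val ≠ n ∧ q.val = p.val + 1 then 1 else 0) +
      (if q.val = n ∧ p.val = 0 ∨ q.val ≠ n ∧ p.val = q.val + 1 then 1 else 0) := by
  simp only [affineA]
  rw [mod_eq_ite (by omega), mod_eq_ite (by omega)]
  congr 2 <;> simp only [eq_iff_iff] <;> split_ifs <;> omega

theorem isAffine_entryA {k : ℕ} (hk : 2 ≤ k) : (entryA k).IsAffine := by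
  rw [entryA]
  -- Rows occupy the odd vertices of the cycle and columns the even ones; row `i`, counted from `0`,
  -- then lies between columns `i` and `i + 1`.
  refine .intro (fun i : Fin k => (⟨2 * i.val + 1, by omega⟩ : Fin (2 * k - 1 + 1)))
    (fun j : Fin k => (⟨2 * j.val, by omega⟩ : Fin (2 * k - 1 + 1)))
    (fun _ => 1) (by omega) ?_ ?_ ?_ ?_ ?_ ?_ ?_ ?_ ?_ ?_ ?_ ?_
  · rintro ⟨i, hi⟩ ⟨j, hj⟩ h
    simp only [Fin.mk.injEq] at h ⊢
    omega
  · rintro ⟨i, hi⟩ ⟨j, hj⟩ h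
    simp only [Fin.mk.injEq] at h ⊢
    omega
  · rintro ⟨i, hi⟩ ⟨j, hj⟩ h
    simp only [Fin.mk.injEq] at h
    omega
  · intro p q
    exact add_comm _ _
  · rintro ⟨i, hi⟩ ⟨j, hj⟩
    rw [affineA_apply]
    have hmod : (j + 1 ≡ i + 1 + 1 [MOD k]) ↔ j = if i + 1 = k then 0 else i + 1 := by
      rw [← mod_eq_ite hi]
      constructor
      · intro h
        have := Nat.ModEq.add_right_cancel' 1 h
        rw [Nat.ModEq, Nat.mod_eq_of_lt hj] at this
        exact this
      · intro h
        rw [h]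
        exact (Nat.mod_modEq _ _).add_right 1
    simp only [zeroOne, hmod]
    split_ifs <;> omega
  · rintro ⟨i, hi⟩ ⟨j, hj⟩
    rw [affineA_apply, if_neg (by dsimp only; omega), if_neg (by dsimp only; omega)]
  · rintro ⟨i, hi⟩ ⟨j, hj⟩
    rw [affineA_apply, if_neg (by dsimp only; omega), if_neg (by dsimp only; omega)]
  · intro; rfl
  · intro; rfl
  · intro; exact one_pos
  · exact ⟨(⟨0, by omega⟩ : Fin (2 * k - 1 + 1)), rfl⟩
  · intro p
    have hp : p.val < 2 * k - 1 + 1 := p.isLt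
    simp only [affineA_apply, mul_one, Finset.sum_add_distrib]
    -- One neighbour is the cyclic successor of `p`, the other its cyclic predecessor.
    refine Nat.add_le_add (a := 1) (c := 1) ?_ ?_
    · refine le_trans ?_ (Finset.single_le_sum (fun _ _ => Nat.zero_le _)
        (Finset.mem_univ (⟨if p.val + 1 = 2 * k then 0 else p.val + 1, by split_ifs <;> omega⟩ :
          Fin (2 * k - 1 + 1))))
      rw [if_pos]
      simp only
      split_ifs <;> omega
    · refine le_trans ?_ (Finset.single_le_sum (fun _ _ => Nat.zero_le _)
        (Finset.mem_univ (⟨if p.val = 0 then 2 * k - 1 else p.val - 1, by split_ifs <;> omega⟩ :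
          Fin (2 * k - 1 + 1))))
      rw [if_pos]
      simp only
      split_ifs <;> omega

/-- The positive null vector of `D̃ n`. -/
def affineDVector (n p : ℕ) : ℕ := if p ≤ 1 ∨ n ≤ p + 1 then 1 else 2

theorem affineD_apply {n : ℕ} (hn : 4 ≤ n) (p q : Fin (n + 1)) : affineD n p q =
    if (1 ≤ p.val ∧ q.val = p.val + 1 ∧ q.val + 1 ≤ n) ∨ (p.val = 0 ∧ q.val = 2) ∨
      (p.val + 2 = n ∧ q.val = n) ∨
      (1 ≤ q.val ∧ p.val = q.val + 1 ∧ p.val + 1 ≤ n) ∨ (q.val = 0 ∧ p.val = 2) ∨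
      (q.val + 2 = n ∧ p.val = n) then 1 else 0 := by
  rw [affineD, graphOf]
  congr 1
  simp only [Fin.lt_def, eq_iff_iff]
  omega

theorem sum_le_of_injective {α β : Type*} [Fintype α] [Fintype β] (f : α → ℕ) (g : β → α)
    (hg : Function.Injective g) : ∑ b, f (g b) ≤ ∑ a, f a := by
  classical
  calc ∑ b, f (g b) = ∑ a ∈ Finset.univ.image g, f a := by
        rw [Finset.sum_image fun _ _ _ _ e => hg e]
    _ ≤ _ := Finset.sum_le_sum_of_subset (Finset.subset_univ _)

/-- Only a lower bound is needed, so it is enough to exhibit one, two or three neighbours of each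
vertex. For `n ≥ 5` the branch vertices `2` and `n - 2` are distinct. -/
theorem two_mul_affineDVector_le {n : ℕ} (hn : 5 ≤ n) (p : Fin (n + 1)) :
    2 * affineDVector n p ≤ ∑ q, affineD n p q * affineDVector n q := by
  obtain ⟨p, hp⟩ := p
  have key1 : ∀ a, ∀ ha : a < n + 1, affineD n ⟨p, hp⟩ ⟨a, ha⟩ * affineDVector n a ≤
      ∑ q, affineD n ⟨p, hp⟩ q * affineDVector n q := fun a ha =>
    Finset.single_le_sum (f := fun q => affineD n ⟨p, hp⟩ q * affineDVector n q)
      (fun _ _ => Nat.zero_le _) (Finset.mem_univ (⟨a, ha⟩ : Fin (n + 1)))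
  have key2 : ∀ a b, ∀ ha : a < n + 1, ∀ hb : b < n + 1, a ≠ b →
      affineD n ⟨p, hp⟩ ⟨a, ha⟩ * affineDVector n a +
        affineD n ⟨p, hp⟩ ⟨b, hb⟩ * affineDVector n b ≤
      ∑ q, affineD n ⟨p, hp⟩ q * affineDVector n q := by
    intro a b ha hb hab
    have := sum_le_of_injective (fun q => affineD n ⟨p, hp⟩ q * affineDVector n q)
      (![⟨a, ha⟩, ⟨b, hb⟩] : Fin 2 → Fin (n + 1)) (by
        intro i j
        fin_cases i <;> fin_cases j <;> simp [hab, hab.symm])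
    simpa [Fin.sum_univ_succ] using this
  have key3 : ∀ a b c, ∀ ha : a < n + 1, ∀ hb : b < n + 1, ∀ hc : c < n + 1, a < b → b < c →
      affineD n ⟨p, hp⟩ ⟨a, ha⟩ * affineDVector n a +
        (affineD n ⟨p, hp⟩ ⟨b, hb⟩ * affineDVector n b +
          affineD n ⟨p, hp⟩ ⟨c, hc⟩ * affineDVector n c) ≤
      ∑ q, affineD n ⟨p, hp⟩ q * affineDVector n q := by
    intro a b c ha hb hc hab hbc
    have := sum_le_of_injective (fun q => affineD n ⟨p, hp⟩ q * affineDVector n q)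
      (![⟨a, ha⟩, ⟨b, hb⟩, ⟨c, hc⟩] : Fin 3 → Fin (n + 1)) (by
        intro i j
        fin_cases i <;> fin_cases j <;>
          simp [hab.ne, hab.ne', hbc.ne, hbc.ne', (hab.trans hbc).ne, (hab.trans hbc).ne'])
    simpa [Fin.sum_univ_succ] using this
  have one : ∀ a, ∀ ha : a < n + 1, (1 ≤ p ∧ a = p + 1 ∧ a + 1 ≤ n) ∨ (p = 0 ∧ a = 2) ∨
      (p + 2 = n ∧ a = n) ∨ (1 ≤ a ∧ p = a + 1 ∧ p + 1 ≤ n) ∨ (a = 0 ∧ p = 2) ∨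
      (a + 2 = n ∧ p = n) → affineD n ⟨p, hp⟩ ⟨a, ha⟩ = 1 := by
    intro a ha h
    rw [affineD_apply (by omega), if_pos h]
  rcases Nat.lt_or_ge p 2 with h | h
  · refine le_trans ?_ (key1 2 (by omega))
    rw [one _ _ (by omega)]
    simp only [affineDVector]
    split_ifs <;> omega
  rcases Nat.eq_or_lt_of_le h with h | h
  · refine le_trans ?_ (key3 0 1 3 (by omega) (by omega) (by omega) (by omega) (by omega))
    rw [one _ _ (by omega), one _ _ (by omega), one _ _ (by omega)]
    simp only [affineDVector]
    split_ifs <;> omega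
  rcases Nat.lt_or_ge (p + 2) n with h' | h'
  · refine le_trans ?_ (key2 (p - 1) (p + 1) (by omega) (by omega) (by omega))
    rw [one _ _ (by omega), one _ _ (by omega)]
    simp only [affineDVector]
    split_ifs <;> omega
  rcases Nat.eq_or_lt_of_le h' with h' | h'
  · refine le_trans ?_ (key3 (p - 1) (p + 1) (p + 2) (by omega) (by omega) (by omega) (by omega)
      (by omega))
    rw [one _ _ (by omega), one _ _ (by omega), one _ _ (by omega)]
    simp only [affineDVector]
    split_ifs <;> omega
  · refine le_trans ?_ (key1 (n - 2) (by omega))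
    rw [one _ _ (by omega)]
    simp only [affineDVector]
    split_ifs <;> omega

theorem affineD_symm (n : ℕ) (p q : Fin (n + 1)) : affineD n p q = affineD n q p := by
  rw [affineD, graphOf, graphOf]
  simp only [or_comm]

theorem isAffine_entryDEven {k : ℕ} (hk : 3 ≤ k) : (entryDEven k).IsAffine := by
  rw [entryDEven]
  -- Rows take the even vertices `2, …, 2k - 2`; columns take the four leaves and the odd vertices
  -- between the branch points.
  refine .intro (fun i : Fin (k - 1) => (⟨2 * i.val + 2, by omega⟩ : Fin (2 * k + 1)))
    (fun j : Fin (k + 2) => (⟨if j.val ≤ 1 then j.val else if j.val + 1 ≤ k then 2 * j.val - 1 else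
      j.val + k - 1, by split_ifs <;> omega⟩ : Fin (2 * k + 1)))
    (fun p : Fin (2 * k + 1) => affineDVector (2 * k) p)
    (by omega) ?_ ?_ ?_ ?_ ?_ ?_ ?_ ?_ ?_ ?_ ?_ ?_
  · rintro ⟨i, hi⟩ ⟨j, hj⟩ h
    simp only [Fin.mk.injEq] at h ⊢
    omega
  · rintro ⟨i, hi⟩ ⟨j, hj⟩ h
    simp only [Fin.mk.injEq] at h ⊢
    split_ifs at h <;> omega
  · rintro ⟨i, hi⟩ ⟨j, hj⟩ h
    simp only [Fin.mk.injEq] at h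
    split_ifs at h <;> omega
  · exact affineD_symm (2 * k)
  · rintro ⟨i, hi⟩ ⟨j, hj⟩
    rw [affineD_apply (by omega)]
    simp only [zeroOne]
    congr 1
    simp only [eq_iff_iff]
    split_ifs <;> omega
  · rintro ⟨i, hi⟩ ⟨j, hj⟩
    rw [affineD_apply (by omega), if_neg]
    simp only
    omega
  · rintro ⟨i, hi⟩ ⟨j, hj⟩
    rw [affineD_apply (by omega), if_neg]
    simp only
    split_ifs <;> omega
  · rintro ⟨i, hi⟩
    change affineDVector (2 * k) (2 * i + 2) = 2
    rw [affineDVector, if_neg (by omega)]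
  · rintro ⟨j, hj⟩
    change affineDVector (2 * k) (if j ≤ 1 then j else if j + 1 ≤ k then 2 * j - 1 else
      j + k - 1) = if 3 ≤ j + 1 ∧ j + 1 ≤ k then 2 else 1
    simp only [affineDVector]
    split_ifs <;> omega
  · intro p
    simp only [affineDVector]
    split_ifs <;> omega
  · exact ⟨(⟨0, by omega⟩ : Fin (2 * k + 1)), by simp [affineDVector]⟩
  · exact two_mul_affineDVector_le (by omega)

theorem isAffine_entryDOdd {k : ℕ} (hk : 3 ≤ k) : (entryDOdd k).IsAffine := by
  rw [entryDOdd]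
  -- Here the branch points lie on opposite sides: the leaves `0, 1` are columns, while `2k - 2, 2k
  -- - 1` are rows.
  refine .intro (fun i : Fin k => (⟨if i.val + 1 = k then 2 * k - 1 else 2 * i.val + 2,
      by split_ifs <;> omega⟩ : Fin (2 * k - 1 + 1)))
    (fun j : Fin k => (⟨if j.val ≤ 1 then j.val else 2 * j.val - 1, by split_ifs <;> omega⟩ :
      Fin (2 * k - 1 + 1)))
    (fun p : Fin (2 * k - 1 + 1) => affineDVector (2 * k - 1) p)
    (by omega) ?_ ?_ ?_ ?_ ?_ ?_ ?_ ?_ ?_ ?_ ?_ ?_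
  · rintro ⟨i, hi⟩ ⟨j, hj⟩ h
    simp only [Fin.mk.injEq] at h ⊢
    split_ifs at h <;> omega
  · rintro ⟨i, hi⟩ ⟨j, hj⟩ h
    simp only [Fin.mk.injEq] at h ⊢
    split_ifs at h <;> omega
  · rintro ⟨i, hi⟩ ⟨j, hj⟩ h
    simp only [Fin.mk.injEq] at h
    split_ifs at h <;> omega
  · exact affineD_symm (2 * k - 1)
  · rintro ⟨i, hi⟩ ⟨j, hj⟩
    rw [affineD_apply (by omega)]
    simp only [zeroOne]
    congr 1
    simp only [eq_iff_iff]
    split_ifs <;> omega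
  · rintro ⟨i, hi⟩ ⟨j, hj⟩
    rw [affineD_apply (by omega), if_neg]
    by_cases hi' : i + 1 = k <;> by_cases hj' : j + 1 = k <;>
      simp only [hi', hj', if_true, if_false] <;> omega
  · rintro ⟨i, hi⟩ ⟨j, hj⟩
    rw [affineD_apply (by omega), if_neg]
    simp only
    split_ifs <;> omega
  · rintro ⟨i, hi⟩
    change affineDVector (2 * k - 1) (if i + 1 = k then 2 * k - 1 else 2 * i + 2) =
      if i + 1 ≤ k - 2 then 2 else 1
    simp only [affineDVector]
    split_ifs <;> omega
  · rintro ⟨j, hj⟩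
    change affineDVector (2 * k - 1) (if j ≤ 1 then j else 2 * j - 1) = if 3 ≤ j + 1 then 2 else 1
    simp only [affineDVector]
    split_ifs <;> omega
  · intro p
    simp only [affineDVector]
    split_ifs <;> omega
  · exact ⟨(⟨0, by omega⟩ : Fin (2 * k - 1 + 1)), by simp [affineDVector]⟩
  · exact two_mul_affineDVector_le (by omega)

theorem IsListed.isAffine {E : ListEntry} (hE : IsListed E) : E.IsAffine := by
  rcases hE with rfl | ⟨k, hk, rfl⟩ | rfl | rfl | ⟨k, hk, rfl⟩ | ⟨k, hk, rfl⟩ | rfl | rfl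
  · exact isAffine_entryA1
  · exact isAffine_entryA hk
  · exact isAffine_entryE6
  · exact isAffine_entryD4
  · exact isAffine_entryDEven hk
  · exact isAffine_entryDOdd hk
  · exact isAffine_entryE7
  · exact isAffine_entryE8

end Entries

/-! ### Local configurations that contain a listed diagram. -/

section Subdiagrams

variable {X : Type*} {M : X → X → ℕ}

/-- `D` is a subdiagram of the diagram given by `M`. -/
def IsSubdiagram {n : ℕ} (D : Matrix (Fin n) (Fin n) ℕ) (M : X → X → ℕ) : Prop :=
  ∃ ι : Fin n → X, Function.Injective ι ∧ ∀ p q, D p q ≤ M (ι p) (ι q)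

/-- Some entry of the list has a diagram that is a subdiagram of the one given by `M`. -/
def HasListedSubdiagram (M : X → X → ℕ) : Prop :=
  ∃ E, IsListed E ∧ IsSubdiagram E.diagram M

theorem graphOf_le {N : ℕ} {E : ℕ → ℕ → Prop} [DecidableRel E] (hM : ∀ x y, M x y = M y x)
    (ι : Fin N → X) (h : ∀ p q : Fin N, p < q → E p q → M (ι p) (ι q) ≠ 0) (p q : Fin N) :
    graphOf N E p q ≤ M (ι p) (ι q) := by
  rw [graphOf]
  split_ifs with hE
  · apply Nat.one_le_iff_ne_zero.2
    rcases hE with ⟨h₁, h₂⟩ | ⟨h₁, h₂⟩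
    · exact h p q h₁ h₂
    · rw [hM]
      exact h q p h₁ h₂
  · exact Nat.zero_le _

theorem hasListedSubdiagram_of_two_le (hM : ∀ x y, M x y = M y x) {x y : X} (hxy : x ≠ y)
    (h : 2 ≤ M x y) : HasListedSubdiagram M := by
  have : IsSubdiagram (affineA 1) M := by
    refine ⟨![x, y], ?_, ?_⟩
    · intro p q
      fin_cases p <;> fin_cases q <;> simp [hxy, hxy.symm]
    · intro p q
      rw [affineA_apply]
      have h' := hM x y
      fin_cases p <;> fin_cases q <;> simp <;> omega
  exact ⟨entryA1, .inl rfl, this⟩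

theorem hasListedSubdiagram_of_four (hM : ∀ x y, M x y = M y x) (hM0 : ∀ x, M x x = 0) {u : X}
    (f : Fin 4 → X) (hf : Function.Injective f) (h : ∀ i, M u (f i) ≠ 0) :
    HasListedSubdiagram M := by
  have hu : ∀ i, u ≠ f i := fun i e => h i (by rw [← e, hM0])
  have : IsSubdiagram (affineD 4) M := by
    refine ⟨![f 0, f 1, u, f 2, f 3], ?_, graphOf_le hM _ ?_⟩
    · intro p q
      fin_cases p <;> fin_cases q <;> simp [hu, fun i => (hu i).symm, hf.eq_iff]
    · intro p q
      have h' := fun i => (hM (f i) u).trans_ne (h i)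
      fin_cases p <;> fin_cases q <;> simp [h, h']
  exact ⟨entryD4, .inr (.inr (.inr (.inl rfl))), this⟩

theorem hasListedSubdiagram_of_cycle (hM : ∀ x y, M x y = M y x) {k : ℕ} (hk : 2 ≤ k) (g : ℕ → X)
    (hg : ∀ i j, i < 2 * k → j < 2 * k → g i = g j → i = j)
    (hadj : ∀ i, i < 2 * k → M (g i) (g (i + 1)) ≠ 0) (hclose : g (2 * k) = g 0) :
    HasListedSubdiagram M := by
  refine ⟨entryA k, .inr (.inl ⟨k, hk, rfl⟩), fun p : Fin (2 * k - 1 + 1) => g p, ?_, ?_⟩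
  · change ∀ p q : Fin (2 * k - 1 + 1), _
    intro p q h
    exact Fin.ext (hg _ _ (by omega) (by omega) h)
  · have key : ∀ p q : Fin (2 * k - 1 + 1),
        (p.val = 2 * k - 1 ∧ q.val = 0 ∨ p.val ≠ 2 * k - 1 ∧ q.val = p.val + 1) →
        1 ≤ M (g p) (g q) := by
      intro p q h
      apply Nat.one_le_iff_ne_zero.2
      rcases h with ⟨h₁, h₂⟩ | ⟨h₁, h₂⟩
      · have e : g q = g (2 * k - 1 + 1) := by
          rw [h₂, show 2 * k - 1 + 1 = 2 * k by omega, hclose]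
        rw [e, h₁]
        exact hadj _ (by omega)
      · rw [h₂]
        exact hadj p (by omega)
    change ∀ p q : Fin (2 * k - 1 + 1), affineA (2 * k - 1) p q ≤ _
    intro p q
    rw [affineA_apply]
    have h₁ := key p q
    have h₂ := key q p
    rw [hM] at h₂
    split_ifs with h h'
    · omega
    · exact h₁ h
    · exact h₂ (by assumption)
    · exact Nat.zero_le _

theorem hasListedSubdiagram_of_affineD (hM : ∀ x y, M x y = M y x) {n : ℕ} (hn : 5 ≤ n)
    (g : ℕ → X) (hinj : ∀ i j, i < j → j ≤ n → g i ≠ g j)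
    (hadj : ∀ i, 1 ≤ i → i + 2 ≤ n → M (g i) (g (i + 1)) ≠ 0)
    (h0 : M (g 0) (g 2) ≠ 0) (hlast : M (g (n - 2)) (g n) ≠ 0) : HasListedSubdiagram M := by
  have hι : Function.Injective fun p : Fin (n + 1) => g p := by
    intro p q hpq
    rcases lt_trichotomy p q with hlt | heq | hlt
    · exact absurd hpq (hinj p q hlt (by omega))
    · exact heq
    · exact absurd hpq.symm (hinj q p hlt (by omega))
  have hle : ∀ p q : Fin (n + 1), affineD n p q ≤ M (g p) (g q) := by
    apply graphOf_le hM fun p : Fin (n + 1) => g p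
    rintro p q - (⟨h₁, h₂, h₃⟩ | ⟨h₁, h₂⟩ | ⟨h₁, h₂⟩)
    · rw [h₂]
      exact hadj p h₁ (by omega)
    · rw [h₁, h₂]
      exact h0
    · rw [h₂, show p.val = n - 2 by omega]
      exact hlast
  -- The two `D̃` families of the list are told apart by the parity of `n`; an odd `n = 2k + 1` is
  -- `2(k + 1) - 1`.
  rcases Nat.even_or_odd' n with ⟨k, rfl | rfl⟩
  · exact ⟨entryDEven k, .inr (.inr (.inr (.inr (.inl ⟨k, by omega, rfl⟩)))), _, hι, hle⟩
  · exact ⟨entryDOdd (k + 1), .inr (.inr (.inr (.inr (.inr (.inl ⟨k + 1, by omega, rfl⟩))))), _,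
      hι, hle⟩

end Subdiagrams

/-! ### Rooted trees: two branch vertices, and the null vector along an arm. -/

section Trees

variable {X : Type*} {M : X → X → ℕ}

/-- `h` is the distance from the root `u` of a tree. -/
structure IsHeight (M : X → X → ℕ) (u : X) (h : X → ℕ) : Prop where
  eq_zero_iff : ∀ x, h x = 0 ↔ x = u
  adj : ∀ x y, M x y ≠ 0 → h y = h x + 1 ∨ h x = h y + 1
  exists_parent : ∀ x, x ≠ u → ∃ y, M x y ≠ 0 ∧ h x = h y + 1
  parent_unique : ∀ x y z, M x y ≠ 0 → M x z ≠ 0 → h x = h y + 1 → h x = h z + 1 → y = z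

variable {u : X} {h : X → ℕ}

/-- Following parents from `v` reaches the root. Recording heights along the path makes its vertices
visibly distinct. -/
theorem IsHeight.exists_path (H : IsHeight M u h) (hM : ∀ x y, M x y = M y x) (n : ℕ) :
    ∀ v, h v = n → ∃ g : ℕ → X, (∀ i ≤ n, h (g i) = i) ∧ g n = v ∧
      ∀ i < n, M (g i) (g (i + 1)) ≠ 0 := by
  induction n with
  | zero =>
    intro v hv
    refine ⟨fun _ => v, fun i hi => ?_, rfl, fun i hi => absurd hi (by omega)⟩
    rw [hv]; omega
  | succ n ih =>
    intro v hv
    obtain ⟨y, hy, hvy⟩ := H.exists_parent v fun e => by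
      rw [(H.eq_zero_iff v).2 e] at hv; omega
    obtain ⟨g, hg, hgn, hadj⟩ := ih y (by omega)
    refine ⟨fun i => if i ≤ n then g i else v, fun i hi => ?_, ?_, fun i hi => ?_⟩
    · simp only
      split_ifs with hin
      · exact hg i hin
      · omega
    · simp
    · simp only
      rw [if_pos (by omega)]
      split_ifs with hin
      · exact hadj i (by omega)
      · rw [show i = n by omega, hgn, hM]
        exact hy

/-- A bad neighbour of a branch vertex will be the one on the path to the other branch vertex; two
neighbours remain to serve as leaves. -/
theorem exists_two_of_three {bad : X → Prop} (f : Fin 3 → X) (hf : Function.Injective f)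
    (hbad : ∀ i j, bad (f i) → bad (f j) → i = j) :
    ∃ i j, f i ≠ f j ∧ ¬ bad (f i) ∧ ¬ bad (f j) := by
  by_cases h₀ : bad (f 0)
  · exact ⟨1, 2, fun e => absurd (hf e) (by decide),
      fun e => absurd (hbad _ _ h₀ e) (by decide), fun e => absurd (hbad _ _ h₀ e) (by decide)⟩
  · by_cases h₁ : bad (f 1)
    · exact ⟨0, 2, fun e => absurd (hf e) (by decide), h₀,
        fun e => absurd (hbad _ _ h₁ e) (by decide)⟩
    · exact ⟨0, 1, fun e => absurd (hf e) (by decide), h₀, h₁⟩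

/-- A tree with two branch vertices contains some `D̃ n` with `n ≥ 5`. -/
theorem IsHeight.hasListedSubdiagram_of_two_branches (H : IsHeight M u h)
    (hM : ∀ x y, M x y = M y x) {v : X} (hv : v ≠ u) (f f' : Fin 3 → X)
    (hf : Function.Injective f) (hf' : Function.Injective f')
    (hadj : ∀ i, M u (f i) ≠ 0) (hadj' : ∀ i, M v (f' i) ≠ 0) : HasListedSubdiagram M := by
  have hu := (H.eq_zero_iff u).2 rfl
  have hv0 : h v ≠ 0 := mt (H.eq_zero_iff v).1 hv
  obtain ⟨g, hg, hgv, hgadj⟩ := H.exists_path hM (h v) v rfl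
  have hg0 : g 0 = u := (H.eq_zero_iff _).1 (hg 0 (Nat.zero_le _))
  obtain ⟨i, j, hij, hi, hj⟩ := exists_two_of_three (bad := fun x => x = g 1) f hf
    fun i j hi hj => hf (hi.trans hj.symm)
  obtain ⟨i', j', hij', hi', hj'⟩ := exists_two_of_three (bad := fun x => h v = h x + 1) f' hf'
    fun i j hi hj => hf' (H.parent_unique v _ _ (hadj' i) (hadj' j) hi hj)
  have hchild : ∀ i, h (f i) = 1 := by
    intro i
    rcases H.adj _ _ (hadj i) with h' | h' <;> omega
  have hchild' : ∀ i, ¬ h v = h (f' i) + 1 → h (f' i) = h v + 1 := by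
    intro i hi
    exact (H.adj _ _ (hadj' i)).resolve_right hi
  have hi' := hchild' _ hi'
  have hj' := hchild' _ hj'
  have hai := hchild i
  have haj := hchild j
  have hadji := hadj i
  have hadjj := hadj j
  have hadji' := hadj' i'
  have hadjj' := hadj' j'
  generalize f i = a at *
  generalize f j = b at *
  generalize f' i' = a' at *
  generalize f' j' = b' at *
  have hga : ∀ k ≤ h v, a ≠ g k := by
    intro k hk e
    have := hg k hk
    rw [← e, hai] at this
    exact hi (this ▸ e)
  have hgb : ∀ k ≤ h v, b ≠ g k := by
    intro k hk e
    have := hg k hk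
    rw [← e, haj] at this
    exact hj (this ▸ e)
  -- The subdiagram is `D̃ (h v + 4)`: leaves `a, b` at the root, the path from `u` to `v` shifted
  -- by two, and leaves `a', b'` at `v`. Heights separate its vertices, except for `a`, `b`, `g 1`
  -- and the pair `a', b'`.
  let F : ℕ → X := fun k => if k = 0 then a else if k = 1 then b else
    if k ≤ h v + 2 then g (k - 2) else if k = h v + 3 then a' else b'
  have F0 : F 0 = a := rfl
  have F1 : F 1 = b := rfl
  have Fg : ∀ k ≤ h v, F (k + 2) = g k := fun k hk => by simp [F, hk]
  have Fa : F (h v + 3) = a' := by simp [F]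
  have Fb : F (h v + 4) = b' := by simp [F]
  have hcases : ∀ k ≤ h v + 4, k = 0 ∨ k = 1 ∨ (∃ l ≤ h v, k = l + 2) ∨ k = h v + 3 ∨
      k = h v + 4 := by
    intro k hk
    by_cases hk' : 2 ≤ k ∧ k ≤ h v + 2
    · exact .inr (.inr (.inl ⟨k - 2, by omega, by omega⟩))
    · omega
  refine hasListedSubdiagram_of_affineD hM (n := h v + 4) (by omega) F ?_ ?_ ?_ ?_
  · intro k l hkl hl e
    have e' := congrArg h e
    rcases hcases k (by omega) with rfl | rfl | ⟨k, hk', rfl⟩ | rfl | rfl <;>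
    rcases hcases l hl with rfl | rfl | ⟨l, hl', rfl⟩ | rfl | rfl <;>
    first
    | omega
    | (try simp only [F0, F1, Fa, Fb] at e e'
       first
       | exact hij e
       | exact hij' e
       | omega
       | (rw [Fg _ hl'] at e e'
          first
          | exact hga _ hl' e
          | exact hgb _ hl' e
          | (rw [Fg _ hk', hg _ hk', hg _ hl'] at e'
             omega))
       | (rw [Fg _ hk', hg _ hk'] at e'
          omega))
  · intro k hk hkn
    rcases hcases k (by omega) with rfl | rfl | ⟨l, hl, rfl⟩ | rfl | rfl
    · omega
    · rw [F1, Fg 0 (by omega), hg0, hM]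
      exact hadjj
    · rw [Fg l hl]
      rcases Nat.lt_or_ge l (h v) with hl' | hl'
      · rw [show l + 2 + 1 = (l + 1) + 2 by ring, Fg _ (by omega)]
        exact hgadj l hl'
      · have : l = h v := by omega
        rw [this, Fa, hgv]
        exact hadji'
    · omega
    · omega
  · rw [F0, Fg 0 (by omega), hg0, hM]
    exact hadji
  · rw [show h v + 4 - 2 = h v + 2 by omega, Fg _ le_rfl, Fb, hgv]
    exact hadjj'

theorem IsNullVector.sum_eq_sum_filter [Fintype X] {d : X → ℕ} (hd : IsNullVector M d)
    (hM1 : ∀ x y, M x y ≤ 1) (x : X) :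
    2 * d x = ∑ y ∈ Finset.univ.filter (fun y => M x y ≠ 0), d y := by
  rw [← hd.sum_eq, Finset.sum_filter]
  refine Finset.sum_congr rfl fun y _ => ?_
  have := hM1 x y
  split_ifs with hxy
  · rw [show M x y = 1 by omega, one_mul]
  · rw [show M x y = 0 by omega, zero_mul]

/-- In a tree without branch vertices other than the root, the null vector decreases linearly along
the arms. -/
theorem IsHeight.exists_arm [Fintype X] {d : X → ℕ} (H : IsHeight M u h) (hd : IsNullVector M d)
    (hM1 : ∀ x y, M x y ≤ 1)
    (hdeg : ∀ x, x ≠ u → (Finset.univ.filter fun y => M x y ≠ 0).card ≤ 2)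
    (x p : X) (hp : M x p ≠ 0) (hxp : h x = h p + 1) :
    ∃ l, 1 ≤ l ∧ (l + 1) * d x = l * d p ∧ ∃ g : ℕ → X, g 0 = x ∧
      (∀ i < l, h (g i) = h x + i) ∧ ∀ i, i + 1 < l → M (g i) (g (i + 1)) ≠ 0 := by
  classical
  obtain ⟨B, hB⟩ := (Set.finite_range h).bddAbove
  have hB : ∀ x, h x ≤ B := fun x => hB ⟨x, rfl⟩
  -- Induction from the far end of the arm towards the root. Here `l` counts the vertices of the arm
  -- from `x` on, and `d` behaves as if it reached zero one step past the end.
  induction hn : B + 1 - h x generalizing x p with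
  | zero =>
    have := hB x
    omega
  | succ n ih =>
    have hxu : x ≠ u := by
      intro e
      rw [(H.eq_zero_iff x).2 e] at hxp
      omega
    have hmem : p ∈ Finset.univ.filter fun y => M x y ≠ 0 := by simpa using hp
    have hsum := hd.sum_eq_sum_filter hM1 x
    rw [← Finset.add_sum_erase _ _ hmem] at hsum
    have hcard := hdeg x hxu
    rw [← Finset.card_erase_add_one hmem] at hcard
    generalize hS : (Finset.univ.filter fun y => M x y ≠ 0).erase p = S at hsum hcard
    have hcases : S.card = 0 ∨ S.card = 1 := by omega
    rcases hcases with h0 | h1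
    · rw [Finset.card_eq_zero] at h0
      rw [h0, Finset.sum_empty] at hsum
      refine ⟨1, le_rfl, by omega, fun _ => x, rfl, fun i hi => ?_, fun i hi => by omega⟩
      rw [show i = 0 by omega, add_zero]
    · obtain ⟨c, hc⟩ := Finset.card_eq_one.1 h1
      rw [hc, Finset.sum_singleton] at hsum
      have hcS : c ∈ (Finset.univ.filter fun y => M x y ≠ 0).erase p := by
        rw [hS, hc]; exact Finset.mem_singleton_self c
      rw [Finset.mem_erase, Finset.mem_filter] at hcS
      obtain ⟨hcp, -, hcx⟩ := hcS
      have hch : h c = h x + 1 := (H.adj x c hcx).resolve_right fun e =>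
        hcp (H.parent_unique x c p hcx hp e hxp)
      obtain ⟨l, hl, hdl, g, hg0, hg, hgadj⟩ := ih c x (by rwa [hd.symm]) hch (by omega)
      refine ⟨l + 1, by omega, ?_, fun i => Nat.casesOn i x g, rfl, ?_, ?_⟩
      -- Multiply `2 d x = d p + d c` by `l + 1` and substitute `(l + 1) d c = l d x`.
      · nlinarith
      · rintro (_ | i) hi
        · rfl
        · change h (g i) = _
          rw [hg i (by omega), hch]
          ring
      · rintro (_ | i) hi
        · change M x (g 0) ≠ 0
          rwa [hg0]
        · exact hgadj i (by omega)

end Trees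

/-! ### Stars with three arms, leading to `Ẽ 6`, `Ẽ 7` and `Ẽ 8`. -/

section Stars

variable {X : Type*} {M : X → X → ℕ} {u : X} {h : X → ℕ}

/-- Vertex `0` of the pattern is the centre; any other vertex `p` goes to position `pos p` of arm
`arm p`. For a concrete pattern, `hap` and `hE` are then decidable. -/
theorem IsHeight.isSubdiagram_of_arms (H : IsHeight M u h) (hM : ∀ x y, M x y = M y x)
    {len : Fin 3 → ℕ} {G : Fin 3 → ℕ → X} (hroot : ∀ a, M u (G a 0) ≠ 0)
    (hinj : Function.Injective fun a => G a 0) (hh : ∀ a i, i < len a → h (G a i) = i + 1)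
    (hadj : ∀ a i, i + 1 < len a → M (G a i) (G a (i + 1)) ≠ 0)
    {N : ℕ} {E : ℕ → ℕ → Prop} [DecidableRel E] (arm : Fin N → Fin 3) (pos : Fin N → ℕ)
    (hpos : ∀ p : Fin N, p.val ≠ 0 → pos p < len (arm p))
    (hap : ∀ p q : Fin N, p.val ≠ 0 → q.val ≠ 0 → arm p = arm q → pos p = pos q → p = q)
    (hE : ∀ p q : Fin N, p < q → E p q → p.val = 0 ∧ pos q = 0 ∨
      p.val ≠ 0 ∧ arm p = arm q ∧ pos q = pos p + 1) :
    IsSubdiagram (graphOf N E) M := by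
  have hu := (H.eq_zero_iff u).2 rfl
  -- Arms meeting at one height meet at every smaller height, since parents are unique, hence
  -- already at their first vertices.
  have hG : ∀ i a b, i < len a → i < len b → G a i = G b i → a = b := by
    intro i
    induction i with
    | zero => exact fun a b _ _ e => hinj e
    | succ i ih =>
      intro a b ha hb e
      refine ih a b (by omega) (by omega) (H.parent_unique (G a (i + 1)) _ _ ?_ ?_ ?_ ?_)
      · rw [hM]
        exact hadj a i ha
      · rw [hM, e]
        exact hadj b i hb
      · rw [hh _ _ ha, hh _ _ (by omega)]
      · rw [hh _ _ ha, hh _ _ (by omega)]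
  refine ⟨fun p => if p.val = 0 then u else G (arm p) (pos p), ?_, graphOf_le hM _ ?_⟩
  · intro p q hpq
    simp only at hpq
    have hpq' := congrArg h hpq
    by_cases hp : p.val = 0 <;> by_cases hq : q.val = 0
    · exact Fin.ext (hp.trans hq.symm)
    · rw [if_pos hp, if_neg hq, hu, hh _ _ (hpos q hq)] at hpq'
      omega
    · rw [if_neg hp, if_pos hq, hu, hh _ _ (hpos p hp)] at hpq'
      omega
    · rw [if_neg hp, if_neg hq] at hpq hpq'
      rw [hh _ _ (hpos p hp), hh _ _ (hpos q hq)] at hpq'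
      have he : pos p = pos q := by omega
      refine hap p q hp hq (hG (pos p) _ _ (hpos p hp) (he ▸ hpos q hq) ?_) he
      rw [hpq, he]
  · intro p q hpq hEpq
    have hq : q.val ≠ 0 := by
      have := Fin.lt_def.1 hpq
      omega
    rcases hE p q hpq hEpq with ⟨hp, hq0⟩ | ⟨hp, ha, hs⟩
    · rw [if_pos hp, if_neg hq, hq0]
      exact hroot _
    · have hlt := hpos q hq
      rw [if_neg hp, if_neg hq, hs, ha]
      exact hadj _ _ (by omega)

/-- Since `x / D = 1 - 1 / (l + 1)` on each arm, the three numbers `1 / (l + 1)` add up to `1`. The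
ordered solutions are `(2, 2, 2)`, `(1, 3, 3)` and `(1, 2, 5)`; lower bounds on the lengths suffice
for embedding. -/
theorem arm_lengths {D x₀ x₁ x₂ l₀ l₁ l₂ : ℕ} (hD : 0 < D) (h : x₀ + x₁ + x₂ = 2 * D)
    (h₀ : (l₀ + 1) * x₀ = l₀ * D) (h₁ : (l₁ + 1) * x₁ = l₁ * D) (h₂ : (l₂ + 1) * x₂ = l₂ * D)
    (hl : 1 ≤ l₀) (h₀₁ : l₀ ≤ l₁) (h₁₂ : l₁ ≤ l₂) :
    2 ≤ l₀ ∧ 2 ≤ l₁ ∧ 2 ≤ l₂ ∨ 1 ≤ l₀ ∧ 3 ≤ l₁ ∧ 3 ≤ l₂ ∨ 1 ≤ l₀ ∧ 2 ≤ l₁ ∧ 5 ≤ l₂ := by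
  by_contra hcon
  have hl₀ : l₀ = 1 := by omega
  have hlt : x₂ < D := by
    by_contra hge
    have := Nat.mul_le_mul_left (l₂ + 1) (not_lt.1 hge)
    nlinarith
  subst hl₀
  have hl₁ : l₁ = 1 ∨ l₁ = 2 := by omega
  rcases hl₁ with rfl | rfl
  · omega
  · have hl₂ : l₂ ≤ 4 := by omega
    interval_cases l₂ <;> omega

theorem IsHeight.hasListedSubdiagram_of_arms (H : IsHeight M u h) (hM : ∀ x y, M x y = M y x)
    {d : X → ℕ} (hd : 0 < d u)
    {len : Fin 3 → ℕ} {G : Fin 3 → ℕ → X} (hlen : ∀ a, 1 ≤ len a) (hroot : ∀ a, M u (G a 0) ≠ 0)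
    (hinj : Function.Injective fun a => G a 0) (hh : ∀ a i, i < len a → h (G a i) = i + 1)
    (hadj : ∀ a i, i + 1 < len a → M (G a i) (G a (i + 1)) ≠ 0)
    (hlin : ∀ a, (len a + 1) * d (G a 0) = len a * d u)
    (hsum : ∑ a, d (G a 0) = 2 * d u) : HasListedSubdiagram M := by
  wlog hmono : Monotone len generalizing len G
  · have hm := Tuple.monotone_sort len
    refine this (len := len ∘ Tuple.sort len) (G := G ∘ Tuple.sort len) (fun a => hlen _)
      (fun a => hroot _) (hinj.comp (Tuple.sort len).injective) (fun a => hh _) (fun a => hadj _)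
      (fun a => hlin _) ?_ hm
    rw [← hsum]
    exact Equiv.sum_comp (Tuple.sort len) fun a => d (G a 0)
  have h₀₁ : len 0 ≤ len 1 := hmono (by decide)
  have h₁₂ : len 1 ≤ len 2 := hmono (by decide)
  rw [Fin.sum_univ_three] at hsum
  rcases arm_lengths hd hsum (hlin 0) (hlin 1) (hlin 2) (hlen 0) h₀₁ h₁₂ with
    ⟨g₀, g₁, g₂⟩ | ⟨g₀, g₁, g₂⟩ | ⟨g₀, g₁, g₂⟩
  · have : IsSubdiagram affineE6 M := by
      rw [affineE6]
      -- The two vectors are `arm` and `pos`; their first entry belongs to the centre and is a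
      -- dummy. Arms are sorted, so arm `2` is a longest one.
      refine H.isSubdiagram_of_arms hM hroot hinj hh hadj
        ![0, 0, 0, 1, 1, 2, 2] ![0, 0, 1, 0, 1, 0, 1] ?_ (by decide) (by decide)
      intro p hp
      fin_cases p <;> simp at hp ⊢ <;> omega
    exact ⟨entryE6, .inr (.inr (.inl rfl)), this⟩
  · have : IsSubdiagram affineE7 M := by
      rw [affineE7]
      refine H.isSubdiagram_of_arms hM hroot hinj hh hadj
        ![0, 1, 1, 1, 2, 2, 2, 0] ![0, 0, 1, 2, 0, 1, 2, 0] ?_ (by decide) (by decide)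
      intro p hp
      fin_cases p <;> simp at hp ⊢ <;> omega
    exact ⟨entryE7, .inr (.inr (.inr (.inr (.inr (.inr (.inl rfl)))))), this⟩
  · have : IsSubdiagram affineE8 M := by
      rw [affineE8]
      refine H.isSubdiagram_of_arms hM hroot hinj hh hadj
        ![0, 2, 2, 2, 2, 2, 1, 1, 0] ![0, 0, 1, 2, 3, 4, 0, 1, 0] ?_ (by decide) (by decide)
      intro p hp
      fin_cases p <;> simp at hp ⊢ <;> omega
    exact ⟨entryE8, .inr (.inr (.inr (.inr (.inr (.inr (.inr rfl)))))), this⟩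

end Stars

/-! ### Every connected bipartite diagram with a null vector contains a listed one. -/

section Classification

variable {X : Type*}

theorem isHeight_dist {G : SimpleGraph X} {M : X → X → ℕ} (hG : ∀ x y, G.Adj x y ↔ M x y ≠ 0)
    (ht : G.IsTree) (u : X) : IsHeight M u (G.dist u) := by
  classical
  -- A shortest path to `y` cannot pass through the farther vertex `x`, so in a tree `y` is the last
  -- vertex before `x` on the path from `u`. This gives uniqueness of parents.
  have hpen : ∀ x y, M x y ≠ 0 → G.dist u x = G.dist u y + 1 →
      ∀ p : G.Walk u x, p.IsPath → y = p.penultimate := by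
    intro x y hxy hdist p hp
    have hadj := (hG x y).2 hxy
    obtain ⟨q, hq, hql⟩ := ht.connected.exists_path_of_dist u y
    refine ht.isAcyclic.eq_penultimate_of_adj_end hp hadj
      (ht.isAcyclic.mem_support_of_ne_mem_support_of_adj_of_isPath hp hq hadj fun hx => ?_)
    have h₁ := G.dist_le (q.takeUntil x hx)
    have h₂ := q.length_takeUntil_le_length hx
    omega
  constructor
  · intro x
    rw [ht.connected.dist_eq_zero_iff, eq_comm]
  · intro x y hxy
    exact (ht.dist_eq_dist_add_one_of_adj u ((hG x y).2 hxy)).symm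
  · intro x hx
    obtain ⟨p, hp, hpl⟩ := ht.connected.exists_path_of_dist u x
    have hnil : ¬ p.Nil := SimpleGraph.Walk.not_nil_of_ne (Ne.symm hx)
    refine ⟨p.penultimate, (hG _ _).1 (p.adj_penultimate hnil).symm, ?_⟩
    have h₁ := G.dist_le p.dropLast
    have h₂ : p.dropLast.length + 1 = p.length := by
      simpa using SimpleGraph.Walk.length_dropLast_add_one hnil
    rcases ht.dist_eq_dist_add_one_of_adj u (p.adj_penultimate hnil) with h' | h' <;> omega
  · intro x y z hy hz hxy hxz
    obtain ⟨p, hp, -⟩ := ht.connected.exists_path_of_dist u x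
    rw [hpen x y hy hxy p hp, hpen x z hz hxz p hp]

variable [Fintype X] {M : X → X → ℕ} {d : X → ℕ}

theorem exists_injective_of_le_card {P : X → Prop} [DecidablePred P] {n : ℕ}
    (h : n ≤ (Finset.univ.filter P).card) :
    ∃ f : Fin n → X, Function.Injective f ∧ ∀ i, P (f i) := by
  obtain ⟨f⟩ := Function.Embedding.nonempty_of_card_le (α := Fin n) (β := {x // P x})
    (by rwa [Fintype.card_fin, Fintype.card_subtype])
  exact ⟨fun i => f i, fun i j e => f.injective (Subtype.ext e), fun i => (f i).2⟩

theorem IsNullVector.hasListedSubdiagram_of_isTree (hd : IsNullVector M d)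
    (hM0 : ∀ x, M x x = 0) (hM1 : ∀ x y, M x y ≤ 1)
    {G : SimpleGraph X} (hG : ∀ x y, G.Adj x y ↔ M x y ≠ 0)
    (ht : G.IsTree) : HasListedSubdiagram M := by
  classical
  have := ht.connected.nonempty
  by_cases h4 : ∃ x, 4 ≤ (Finset.univ.filter fun y => M x y ≠ 0).card
  · obtain ⟨x, hx⟩ := h4
    obtain ⟨f, hf, hfx⟩ := exists_injective_of_le_card hx
    exact hasListedSubdiagram_of_four hd.symm hM0 f hf hfx
  push Not at h4
  -- The root is a branch vertex if there is one, so any further branch vertex yields a pair.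
  obtain ⟨u, hu⟩ : ∃ u, ∀ x, x ≠ u → 3 ≤ (Finset.univ.filter fun y => M x y ≠ 0).card →
      3 ≤ (Finset.univ.filter fun y => M u y ≠ 0).card := by
    by_cases h3 : ∃ x, 3 ≤ (Finset.univ.filter fun y => M x y ≠ 0).card
    · exact ⟨h3.choose, fun _ _ _ => h3.choose_spec⟩
    · exact ⟨Classical.arbitrary X, fun x _ hx => absurd ⟨x, hx⟩ h3⟩
  have H := isHeight_dist hG ht u
  by_cases h3 : ∃ v, v ≠ u ∧ 3 ≤ (Finset.univ.filter fun y => M v y ≠ 0).card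
  · obtain ⟨v, hvu, hv⟩ := h3
    obtain ⟨f, hf, hfx⟩ := exists_injective_of_le_card (hu v hvu hv)
    obtain ⟨f', hf', hfx'⟩ := exists_injective_of_le_card hv
    exact H.hasListedSubdiagram_of_two_branches hd.symm hvu f f' hf hf' hfx hfx'
  push Not at h3
  have harm : ∀ x, M u x ≠ 0 → ∃ l, 1 ≤ l ∧ (l + 1) * d x = l * d u ∧ ∃ g : ℕ → X, g 0 = x ∧
      (∀ i < l, G.dist u (g i) = i + 1) ∧ ∀ i, i + 1 < l → M (g i) (g (i + 1)) ≠ 0 := by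
    intro x hx
    have hu0 : G.dist u u = 0 := (H.eq_zero_iff u).2 rfl
    have hx1 : G.dist u x = 1 := by
      rcases H.adj u x hx with h' | h' <;> omega
    obtain ⟨l, hl, hdl, g, hg0, hg, hgadj⟩ := H.exists_arm hd hM1
      (fun x hx => Nat.lt_succ_iff.1 (h3 x hx)) x u (by rwa [hd.symm]) (by omega)
    exact ⟨l, hl, hdl, g, hg0, fun i hi => by rw [hg i hi, hx1, add_comm], hgadj⟩
  have hsum := hd.sum_eq_sum_filter hM1 u
  have hdu := hd.pos u
  have hlt : ∀ x ∈ Finset.univ.filter fun y => M u y ≠ 0, d x < d u := by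
    intro x hx
    obtain ⟨l, -, hdl, -⟩ := harm x (Finset.mem_filter.1 hx).2
    by_contra hge
    have := Nat.mul_le_mul_left (l + 1) (not_lt.1 hge)
    nlinarith
  -- The values at the neighbours add up to `2 d u` and each is below `d u`, so two neighbours are
  -- not enough. In particular a path has no positive null vector.
  have hcard : (Finset.univ.filter fun y => M u y ≠ 0).card = 3 := by
    by_contra hne
    have h2 : (Finset.univ.filter fun y => M u y ≠ 0).card ≤ 2 := by
      have := h4 u
      omega
    have hnon : (Finset.univ.filter fun y => M u y ≠ 0).Nonempty := by
      rw [Finset.nonempty_iff_ne_empty]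
      intro he
      rw [he, Finset.sum_empty] at hsum
      omega
    have := Finset.sum_lt_sum_of_nonempty hnon hlt
    rw [← hsum, Finset.sum_const, smul_eq_mul] at this
    have := Nat.mul_le_mul_right (d u) h2
    omega
  obtain ⟨x, y, z, hxy, hxz, hyz, hxyz⟩ := Finset.card_eq_three.1 hcard
  rw [hxyz, Finset.sum_insert (by simp [hxy, hxz]), Finset.sum_insert (by simp [hyz]),
    Finset.sum_singleton] at hsum
  have hmem : ∀ a : Fin 3, M u ((![x, y, z] : Fin 3 → X) a) ≠ 0 := by
    intro a
    have : (![x, y, z] : Fin 3 → X) a ∈ Finset.univ.filter fun y => M u y ≠ 0 := by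
      rw [hxyz]
      fin_cases a <;> simp
    exact (Finset.mem_filter.1 this).2
  choose len hlen hlin g hg0 hg hgadj using fun a => harm _ (hmem a)
  refine H.hasListedSubdiagram_of_arms hd.symm hdu (len := len) (G := g) hlen
    (fun a => by rw [hg0]; exact hmem a) ?_ hg hgadj (fun a => by rw [hg0]; exact hlin a) ?_
  · simp only [hg0]
    intro a b
    fin_cases a <;> fin_cases b <;> simp [hxy, hxz, hyz, hxy.symm, hxz.symm, hyz.symm]
  · simp only [hg0, Fin.sum_univ_three]
    simp only [Matrix.cons_val]
    omega

/-- A connected bipartite diagram with a positive null vector contains a diagram of the list. -/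
theorem IsNullVector.hasListedSubdiagram [Nonempty X] (hd : IsNullVector M d) (c : X → Bool)
    (hc : ∀ x y, M x y ≠ 0 → c x ≠ c y) : HasListedSubdiagram M := by
  classical
  have hM0 : ∀ x, M x x = 0 := fun x => by
    by_contra hx
    exact hc x x hx rfl
  by_cases h2 : ∃ x y, 2 ≤ M x y
  · obtain ⟨x, y, hxy⟩ := h2
    refine hasListedSubdiagram_of_two_le hd.symm (fun e => ?_) hxy
    rw [e, hM0] at hxy
    omega
  push Not at h2
  let G : SimpleGraph X :=
    { Adj := fun x y => M x y ≠ 0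
      symm := ⟨fun x y hxy => by rwa [hd.symm]⟩
      loopless := ⟨fun x hx => hx (hM0 x)⟩ }
  have hG : ∀ x y, G.Adj x y ↔ M x y ≠ 0 := fun x y => Iff.rfl
  have hconn : G.Connected := by
    rw [SimpleGraph.connected_iff]
    refine ⟨fun x y => ?_, inferInstance⟩
    exact hd.connected (fun y => G.Reachable x y)
      (fun y z hyz hxy => hxy.trans (SimpleGraph.Adj.reachable hyz)) ⟨x, .refl x⟩ y
  by_cases hac : G.IsAcyclic
  · exact hd.hasListedSubdiagram_of_isTree hM0 (fun x y => Nat.lt_succ_iff.1 (h2 x y)) hG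
      ⟨hconn, hac⟩
  · simp only [SimpleGraph.IsAcyclic] at hac
    push Not at hac
    obtain ⟨v, w, hw⟩ := hac
    -- The two-colouring makes the cycle even, and a cycle has length at least three, so `k ≥ 2`.
    have heven : Even w.length :=
      ((SimpleGraph.Coloring.mk c fun {x y} hxy => hc x y hxy).even_length_iff_congr w).2 Iff.rfl
    obtain ⟨k, hk⟩ := heven
    have h3 := hw.three_le_length
    refine hasListedSubdiagram_of_cycle hd.symm (k := k) (by omega) w.getVert ?_ ?_ ?_
    · intro i j hi hj hij
      exact hw.getVert_injOn' (show i ≤ _ by omega) (show j ≤ _ by omega) hij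
    · intro i hi
      exact w.adj_getVert_succ (by omega)
    · rw [show 2 * k = w.length by omega, w.getVert_length, w.getVert_zero]

end Classification

/-! ### Matching the two sides of the diagram with rows and columns. -/

section Bipartite

theorem exists_sumCongr_of_isLeft {α β α' β' : Type*} (Ψ : α ⊕ β ≃ α' ⊕ β')
    (h : ∀ x, (Ψ x).isLeft = x.isLeft) :
    ∃ (σ : α ≃ α') (τ : β ≃ β'), (∀ i, Ψ (.inl i) = .inl (σ i)) ∧ ∀ j, Ψ (.inr j) = .inr (τ j) := by
  have hl : ∀ i, ∃ i', Ψ (.inl i) = .inl i' := fun i => by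
    rw [← Sum.isLeft_iff, h]; rfl
  have hr : ∀ j, ∃ j', Ψ (.inr j) = .inr j' := fun j => by
    rw [← Sum.isRight_iff, ← Sum.not_isLeft, h]; simp
  choose σ hσ using hl
  choose τ hτ using hr
  have hσb : Function.Bijective σ := by
    constructor
    · intro i j hij
      apply Sum.inl_injective
      apply Ψ.injective
      rw [hσ, hσ, hij]
    · intro i'
      obtain ⟨x, hx⟩ := Ψ.surjective (.inl i')
      rcases x with i | j
      · exact ⟨i, Sum.inl_injective (by rw [← hσ, hx])⟩
      · rw [hτ] at hx
        exact absurd hx (by simp)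
  have hτb : Function.Bijective τ := by
    constructor
    · intro i j hij
      apply Sum.inr_injective
      apply Ψ.injective
      rw [hτ, hτ, hij]
    · intro j'
      obtain ⟨x, hx⟩ := Ψ.surjective (.inr j')
      rcases x with i | j
      · rw [hσ] at hx
        exact absurd hx (by simp)
      · exact ⟨j, Sum.inr_injective (by rw [← hτ, hx])⟩
  exact ⟨.ofBijective σ hσb, .ofBijective τ hτb, hσ, hτ⟩

theorem isLeft_eq_not_of_fromBlocks_ne_zero {α β : Type*} {a : Matrix α β ℕ} {x y : α ⊕ β}
    (h : Matrix.fromBlocks 0 a a.transpose 0 x y ≠ 0) : x.isLeft = !y.isLeft := by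
  rcases x with i | i <;> rcases y with j | j <;> simp_all

/-- A connected bipartite diagram with a positive null vector is in the list. -/
theorem exists_listEntry {r s : ℕ} {a : Matrix (Fin r) (Fin s) ℕ} {m : Fin r → ℕ} {n : Fin s → ℕ}
    [Nonempty (Fin r ⊕ Fin s)]
    (hd : IsNullVector (Matrix.fromBlocks 0 a a.transpose 0) (Sum.elim m n)) :
    ∃ E : ListEntry, IsListed E ∧ HasDiagram E a ∧
      ∃ c : ℕ, 0 < c ∧ (Matches E c a m n ∨ Matches E c a.transpose n m) := by
  obtain ⟨E, hE, ι, hι, hle⟩ := hd.hasListedSubdiagram Sum.isLeft fun x y hxy => by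
    rw [isLeft_eq_not_of_fromBlocks_ne_zero hxy]
    exact Bool.not_ne_self _
  obtain ⟨e, δ, he, hsymm, hδ, hpos, ⟨p₁, hp₁⟩, hsub⟩ := hE.isAffine
  have : Nonempty (Fin E.vertices) := ⟨p₁⟩
  obtain ⟨hbij, hEM⟩ := hd.bijective_of_le hsymm hpos hsub hι hle
  have hdim := hd.eq_mul hsymm hpos hsub hι hle hp₁
  set c := Sum.elim m n (ι p₁) with hc
  let Φ : Fin r ⊕ Fin s ≃ Fin E.vertices := (Equiv.ofBijective ι hbij).symm
  have hιΦ : ∀ x, ι (Φ x) = x := fun x => (Equiv.ofBijective ι hbij).apply_symm_apply x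
  have hM : ∀ x y, Matrix.fromBlocks 0 a a.transpose 0 x y = E.diagram (Φ x) (Φ y) := by
    intro x y
    rw [hEM, hιΦ, hιΦ]
  let Ψ : Fin r ⊕ Fin s ≃ Fin E.rows ⊕ Fin E.cols := Φ.trans e.symm
  have hMΨ : ∀ x y, Matrix.fromBlocks 0 a a.transpose 0 x y =
      Matrix.fromBlocks 0 E.mat E.mat.transpose 0 (Ψ x) (Ψ y) := by
    intro x y
    rw [he, hM]
    simp [Ψ]
  have hdΨ : ∀ x, Sum.elim m n x = c * Sum.elim E.rowDim E.colDim (Ψ x) := by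
    intro x
    have := hdim (Φ x)
    rw [hιΦ] at this
    rw [this, ← hδ]
    simp [Ψ]
  -- Every edge changes sides in both diagrams, so by connectedness `Ψ` preserves the side of all
  -- vertices or of none; the second case is the transposition.
  have hflip : ∀ x y, Matrix.fromBlocks 0 a a.transpose 0 x y ≠ 0 →
      (Ψ x).isLeft = x.isLeft → (Ψ y).isLeft = y.isLeft := by
    intro x y hxy hx
    have h₁ := isLeft_eq_not_of_fromBlocks_ne_zero hxy
    rw [hMΨ] at hxy
    have h₂ := isLeft_eq_not_of_fromBlocks_ne_zero hxy
    rw [h₁, h₂] at hx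
    exact Bool.not_inj hx
  refine ⟨E, hE, ⟨Φ, hM⟩, c, hd.pos _, ?_⟩
  by_cases hex : ∃ x, (Ψ x).isLeft = x.isLeft
  · left
    obtain ⟨σ, τ, hσ, hτ⟩ := exists_sumCongr_of_isLeft Ψ (hd.connected _ hflip hex)
    refine ⟨σ, τ, fun i j => ?_, fun i => ?_, fun j => ?_⟩
    · simpa [hσ, hτ] using hMΨ (.inl i) (.inr j)
    · simpa [hσ] using hdΨ (.inl i)
    · simpa [hτ] using hdΨ (.inr j)
  · right
    push Not at hex
    obtain ⟨τ, σ, hτ, hσ⟩ := exists_sumCongr_of_isLeft ((Equiv.sumComm _ _).trans Ψ) (by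
      rintro (x | x)
      · have := hex (.inr x)
        simpa using this
      · have := hex (.inl x)
        simpa using this)
    have hτ : ∀ j, Ψ (.inr j) = .inl (τ j) := hτ
    have hσ : ∀ i, Ψ (.inl i) = .inr (σ i) := hσ
    refine ⟨τ, σ, fun j i => ?_, fun j => ?_, fun i => ?_⟩
    · simpa [hσ, hτ] using hMΨ (.inr j) (.inl i)
    · simpa [hτ] using hdΨ (.inr j)
    · simpa [hσ] using hdΨ (.inl i)

end Bipartite

end PM

/-! ### The classification of multiplicity matrices. -/

theorem theorem4p2 {A B L : Type*} [Ring A] [Algebra ℂ A] [Ring B] [Algebra ℂ B]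
    [AddCommGroup L] [Module ℂ L] [FiniteDimensional ℂ L] [Nontrivial L]
    [Module B L] [Module Aᵐᵒᵖ L]
    [IsScalarTower ℂ B L] [IsScalarTower ℂ Aᵐᵒᵖ L] [SMulCommClass B Aᵐᵒᵖ L]
    {size : ℕ} (S : PM.WeakPMStructure A B L size) (hS : S.IsIndecomposable)
    {r s : ℕ}
    {V : Fin r → Type*} [∀ i, AddCommGroup (V i)] [∀ i, Module ℂ (V i)]
    [∀ i, FiniteDimensional ℂ (V i)] [∀ i, Nontrivial (V i)]
    {W : Fin s → Type*} [∀ j, AddCommGroup (W j)] [∀ j, Module ℂ (W j)]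
    [∀ j, FiniteDimensional ℂ (W j)] [∀ j, Nontrivial (W j)]
    (φ : A ≃ₐ[ℂ] (∀ i, Module.End ℂ (V i))) (ψ : B ≃ₐ[ℂ] (∀ j, Module.End ℂ (W j)))
    (a : Matrix (Fin r) (Fin s) ℕ) (ha : PM.IsMatrixOfMultiplicities L φ ψ a) :
    ∃ E : PM.ListEntry, PM.IsListed E ∧ PM.HasDiagram E a ∧
      ∃ m : ℕ, 0 < m ∧
        (PM.Matches E m a (fun i => Module.finrank ℂ (V i)) (fun j => Module.finrank ℂ (W j)) ∨
          PM.Matches E m a.transpose (fun j => Module.finrank ℂ (W j))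
            (fun i => Module.finrank ℂ (V i))) := by
  -- Without rows the product that models `L` would be trivial, against `L ≠ 0`.
  have hne : Nonempty (Fin r ⊕ Fin s) := by
    obtain ⟨Φ, -⟩ := ha
    by_contra h
    rw [not_nonempty_iff, isEmpty_sum] at h
    have := h.1
    exact not_subsingleton L Φ.toEquiv.subsingleton
  apply PM.exists_listEntry
  refine ⟨?_, ?_, ?_, ?_⟩
  · rintro (i | i) (j | j) <;> simp
  · rintro (i | j)
    · exact Module.finrank_pos
    · exact Module.finrank_pos
  · rintro (i | j)
    · simpa using S.sum_row ha i
    · simpa using S.sum_col ha j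
  · intro P hP hex
    have hiff : ∀ i j, a i j ≠ 0 → (P (.inl i) ↔ P (.inr j)) := fun i j hij =>
      ⟨hP (.inl i) (.inr j) (by simpa using hij), hP (.inr j) (.inl i) (by simpa using hij)⟩
    obtain ⟨h₁, h₂⟩ := hS.connected ha (fun i => P (.inl i)) (fun j => P (.inr j)) hiff (by
      obtain ⟨i | j, h⟩ := hex
      · exact .inl ⟨i, h⟩
      · exact .inr ⟨j, h⟩)
    rintro (i | j)
    · exact h₁ i
    · exact h₂ j
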